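/- Let $D^{1,2}(\mathbb{R}^3)$ be the space of real-valued functions $u\in L^6(\mathbb{R}^3)$ whose weak gradient $\nabla u$ belongs to $L^2(\mathbb{R}^3)$. Let $E_r(\mathbb{R}^3)$ be the space of radial functions $u\in D^{1,2}(\mathbb{R}^3)$ with finite Coulomb energy $$\int_{\mathbb{R}^3}\int_{\mathbb{R}^3}\frac{u^2(x)\,u^2(y)}{|x-y|}\,dx\,dy<+\infty,$$ endowed with the norm $$\|u\|_E=\left(\int_{\mathbb{R}^3}|\nabla u|^2\,dx+\left(\int_{\mathbb{R}^3}\int_{\mathbb{R}^3}\frac{u^2(x)\,u^2(y)}{|x-y|}\,dx\,dy\right)^{1/2}\right)^{1/2}.$$ (As usual, functions are identified when they agree almost everywhere.) Then: 1. For every $p\in(\frac{18}{7},6]$, $E_r(\mathbb{R}^3)\subset L^p(\mathbb{R}^3)$ with continuous inclusion: there is a constant $C=C(p)$ such that $\|u\|_{L^p}\le C\|u\|_E$ for all $u\in E_r(\mathbb{R}^3)$. 2. For every $p\in(\frac{18}{7},6)$ this inclusion is compact: every sequence in $E_r(\mathbb{R}^3)$ that is bounded in $\|\cdot\|_E$ has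 a subsequence that converges in $L^p(\mathbb{R}^3)$. 3. For every $p\in(0,\frac{18}{7})$ and every $p\in(6,\infty]$, $E_r(\mathbb{R}^3)$ is not contained in $L^p(\mathbb{R}^3)$. -/

import Mathlib

open MeasureTheory Filter
open scoped ENNReal NNReal Topology ContDiff

namespace Coulomb

/-- Euclidean space `ℝ³`, with Lebesgue measure `volume`. -/
abbrev R3 : Type := EuclideanSpace ℝ (Fin 3)

/-- `g` is a weak (distributional) gradient of `u` on `ℝ³`:
`∫ u ∂ᵢφ = - ∫ gᵢ φ` for every test function `φ ∈ C₀^∞(ℝ³)` and every `i`. -/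
structure IsWeakGradient (u : R3 → ℝ) (g : R3 → R3) : Prop where
  locallyIntegrable : LocallyIntegrable u volume
  locallyIntegrable_grad : LocallyIntegrable g volume
  integral_eq : ∀ φ : R3 → ℝ, ContDiff ℝ ∞ φ → HasCompactSupport φ → ∀ i : Fin 3,
    ∫ x, u x * fderiv ℝ φ x (EuclideanSpace.single i 1) = - ∫ x, g x i * φ x

open Classical in
/-- The weak gradient of `u` (unique almost everywhere); the value is `0` if there is none. -/
noncomputable def weakGrad (u : R3 → ℝ) : R3 → R3 :=
  if h : ∃ g, IsWeakGradient u g then h.choose else 0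

/-- `u ∈ D^{1,2}(ℝ³)`: `u ∈ L⁶` has a weak gradient in `L²`. -/
structure MemD12 (u : R3 → ℝ) : Prop where
  memLp_six : MemLp u 6 volume
  exists_grad : ∃ g, IsWeakGradient u g ∧ MemLp g 2 volume

/-- The Coulomb energy `∫∫ u(x)² u(y)² / |x - y| dx dy`, with values in `[0, ∞]`. -/
noncomputable def energy (u : R3 → ℝ) : ℝ≥0∞ :=
  ∫⁻ x, ∫⁻ y, ENNReal.ofReal (u x ^ 2 * u y ^ 2 / ‖x - y‖)

/-- `u` is (almost everywhere equal to) a function of `|x|`. -/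
def IsRadial (u : R3 → ℝ) : Prop :=
  ∃ f : ℝ → ℝ, ∀ᵐ x : R3, u x = f ‖x‖

/-- `u ∈ E_r(ℝ³)`: radial functions of `D^{1,2}(ℝ³)` with finite Coulomb energy. -/
structure MemEr (u : R3 → ℝ) : Prop where
  memD12 : MemD12 u
  energy_lt_top : energy u < ⊤
  radial : IsRadial u

/-- The norm of `E`:
`‖u‖_E = (∫ |∇u|² + (∫∫ u(x)² u(y)² / |x - y| dx dy)^{1/2})^{1/2}`, with values in `[0, ∞]`. -/
noncomputable def normE (u : R3 → ℝ) : ℝ≥0∞ :=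
  ((∫⁻ x, ‖weakGrad u x‖ₑ ^ 2) + energy u ^ (1 / 2 : ℝ)) ^ (1 / 2 : ℝ)

end Coulomb

/-!
A radial function `u` with weak gradient in `L²` is almost everywhere `w(|x|)`, where `w` is a
primitive of the spherical mean of the radial part of `∇u`. By Cauchy–Schwarz `w` is Hölder
continuous off the origin and `|w(r)| ≲ r^(-1/2)`, while the Coulomb energy controls the mass:
`∫_{|x| ≤ R} u² ≲ R^(1/2)`. Comparing `w(r)` with its values on `[r, r + r^(1/4)]` gives
`|w(r)| ≲ r^(-7/8)` for `r ≥ 1`. Hence `r² |w|^p ≲ r^(-7(p-2)/8) · r² w²`, and by the mass bound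
this is integrable at infinity as soon as `7(p-2)/8 > 1/2`, that is `p > 18/7`; near the origin
Hardy's inequality and `|w(r)| ≲ r^(-1/2)` suffice for `p ≤ 6`. The bounds are uniform on bounded
sequences, so a pointwise convergent subsequence of the profiles also converges in `L^p` when
`r² r^(-p/2)` is integrable at the origin, that is for `p < 6`.

The counterexamples are sums of bumps of height `h` on disjoint shells `R < |x| ≤ R + l`. Two shells
with `R ≤ R'` have mutual Coulomb energy `≲ R² l · R' l'`, and `R`, `l`, `h` can be taken to be
geometric sequences: comparatively thin shells going to infinity for `p < 18/7`, thick ones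
shrinking to the origin for `p > 6`.
-/

namespace Coulomb

open Set Metric

section Integrals

lemma sq_lintegral_mul_le {α : Type*} [MeasurableSpace α] (μ : Measure α) {f g : α → ℝ≥0∞}
    (hf : AEMeasurable f μ) (hg : AEMeasurable g μ) :
    (∫⁻ x, f x * g x ∂μ) ^ 2 ≤ (∫⁻ x, f x ^ 2 ∂μ) * ∫⁻ x, g x ^ 2 ∂μ := by
  have h := ENNReal.lintegral_mul_le_Lp_mul_Lq μ Real.HolderConjugate.two_two hf hg
  simp only [Pi.mul_apply, ENNReal.rpow_two] at h
  calc (∫⁻ x, f x * g x ∂μ) ^ 2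
      ≤ ((∫⁻ x, f x ^ 2 ∂μ) ^ (1 / 2 : ℝ) * (∫⁻ x, g x ^ 2 ∂μ) ^ (1 / 2 : ℝ)) ^ 2 := by gcongr
    _ = (∫⁻ x, f x ^ 2 ∂μ) * ∫⁻ x, g x ^ 2 ∂μ := by
      rw [mul_pow, ← ENNReal.rpow_two, ← ENNReal.rpow_two, ← ENNReal.rpow_mul, ← ENNReal.rpow_mul]
      norm_num

lemma lintegral_mul_lintegral_Ioi_eq {f g : ℝ → ℝ≥0∞} (a : ℝ)
    (hf : AEMeasurable f (volume.restrict (Ioi a)))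
    (hg : AEMeasurable g (volume.restrict (Ioi a))) :
    ∫⁻ s in Ioi a, f s * ∫⁻ t in Ioi s, g t = ∫⁻ t in Ioi a, g t * ∫⁻ s in Ioo a t, f s := by
  have hl : ∀ s ∈ Ioi a, f s * ∫⁻ t in Ioi s, g t =
      ∫⁻ t in Ioi a, {z : ℝ × ℝ | z.1 < z.2}.indicator (fun z => f z.1 * g z.2) (s, t) := by
    intro s hs
    have hg' := hg.mono_measure (Measure.restrict_mono (Ioi_subset_Ioi (le_of_lt hs)) le_rfl)
    rw [← lintegral_const_mul'' _ hg', ← inter_eq_left.2 (Ioi_subset_Ioi (le_of_lt hs)),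
      ← Measure.restrict_restrict measurableSet_Ioi, ← lintegral_indicator measurableSet_Ioi]
    rfl
  have hr : ∀ t ∈ Ioi a, g t * ∫⁻ s in Ioo a t, f s =
      ∫⁻ s in Ioi a, {z : ℝ × ℝ | z.1 < z.2}.indicator (fun z => f z.1 * g z.2) (s, t) := by
    intro t _
    have hf' := hf.mono_measure
      (Measure.restrict_mono (Ioo_subset_Ioi_self : Ioo a t ⊆ Ioi a) le_rfl)
    rw [mul_comm, ← lintegral_mul_const'' _ hf', ← Iio_inter_Ioi,
      ← Measure.restrict_restrict measurableSet_Iio, ← lintegral_indicator measurableSet_Iio]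
    rfl
  rw [setLIntegral_congr_fun measurableSet_Ioi hl, setLIntegral_congr_fun measurableSet_Ioi hr]
  refine lintegral_lintegral_swap ?_
  exact (hf.comp_fst.mul hg.comp_snd).indicator (measurableSet_lt measurable_fst measurable_snd)

lemma lintegral_rpow_Ioo {a b : ℝ} (ha : -1 < a) (hb : 0 ≤ b) :
    ∫⁻ t in Ioo 0 b, ENNReal.ofReal (t ^ a) = ENNReal.ofReal (b ^ (a + 1) / (a + 1)) := by
  rw [setLIntegral_congr Ioo_ae_eq_Ioc, ← ofReal_integral_eq_lintegral_ofReal,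
    ← intervalIntegral.integral_of_le hb, integral_rpow (.inl ha),
    Real.zero_rpow (by linarith), sub_zero]
  · exact (intervalIntegral.intervalIntegrable_rpow' ha).1
  · filter_upwards [ae_restrict_mem measurableSet_Ioc] with r hr using Real.rpow_nonneg hr.1.le _

lemma lintegral_rpow_Ioi {a b : ℝ} (ha : a < -1) (hb : 0 < b) :
    ∫⁻ t in Ioi b, ENNReal.ofReal (t ^ a) = ENNReal.ofReal (b ^ (a + 1) / (-a - 1)) := by
  rw [← ofReal_integral_eq_lintegral_ofReal, integral_Ioi_rpow_of_lt ha hb, ← neg_div_neg_eq,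
    neg_neg, neg_add']
  · exact integrableOn_Ioi_rpow_of_lt ha hb
  · filter_upwards [ae_restrict_mem measurableSet_Ioi] with r hr
      using Real.rpow_nonneg (hb.trans hr).le _

lemma lintegral_Ioi_rpow_mul_le {f : ℝ → ℝ≥0∞} {M : ℝ≥0∞} {R a b : ℝ} (hR : 0 < R) (ha : 0 < a)
    (hba : b < a) (hf : AEMeasurable f (volume.restrict (Ioi R)))
    (hfM : ∀ s, R < s → ∫⁻ t in Ioo R s, f t ≤ M * ENNReal.ofReal (s ^ b)) :
    ∫⁻ t in Ioi R, ENNReal.ofReal (t ^ (-a)) * f t ≤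
      M * ENNReal.ofReal (a / (a - b) * R ^ (b - a)) := by
  have hpow : ∀ t ∈ Ioi R, ENNReal.ofReal (t ^ (-a)) * f t =
      f t * ∫⁻ s in Ioi t, ENNReal.ofReal (a * s ^ (-a - 1)) := fun t ht => by
    simp_rw [ENNReal.ofReal_mul ha.le]
    rw [lintegral_const_mul _ (by fun_prop), lintegral_rpow_Ioi (by linarith) (hR.trans ht),
      ← ENNReal.ofReal_mul ha.le, mul_comm (f t), sub_add_cancel, neg_sub, sub_neg_eq_add,
      add_sub_cancel_left, mul_div_cancel₀ _ ha.ne']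
  rw [setLIntegral_congr_fun measurableSet_Ioi hpow, lintegral_mul_lintegral_Ioi_eq R hf
    (by fun_prop)]
  calc ∫⁻ s in Ioi R, ENNReal.ofReal (a * s ^ (-a - 1)) * ∫⁻ t in Ioo R s, f t
      ≤ ∫⁻ s in Ioi R, M * ENNReal.ofReal a * ENNReal.ofReal (s ^ (b - a - 1)) := by
        refine setLIntegral_mono' measurableSet_Ioi fun s hs => ?_
        have hs0 : 0 < s := hR.trans hs
        calc _ ≤ ENNReal.ofReal (a * s ^ (-a - 1)) * (M * ENNReal.ofReal (s ^ b)) := by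
              gcongr
              exact hfM s hs
          _ = M * ENNReal.ofReal a * ENNReal.ofReal (s ^ (-a - 1) * s ^ b) := by
              rw [ENNReal.ofReal_mul ha.le, ENNReal.ofReal_mul (by positivity)]
              ring
          _ = _ := by rw [← Real.rpow_add hs0]; ring_nf
    _ = M * ENNReal.ofReal (a / (a - b) * R ^ (b - a)) := by
        rw [lintegral_const_mul _ (by fun_prop), lintegral_rpow_Ioi (by linarith) hR, mul_assoc,
          ← ENNReal.ofReal_mul ha.le]
        congr 2
        ring_nf

lemma sq_lintegral_Ioi_le {f : ℝ → ℝ≥0∞} {r : ℝ} (hr : 0 < r)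
    (hf : AEMeasurable f (volume.restrict (Ioi r))) :
    (∫⁻ t in Ioi r, f t) ^ 2 ≤ ENNReal.ofReal (2 * r ^ (-1 / 2 : ℝ)) *
      ∫⁻ t in Ioi r, ENNReal.ofReal (t ^ (3 / 2 : ℝ)) * f t ^ 2 := by
  have hsplit : ∫⁻ t in Ioi r, f t = ∫⁻ t in Ioi r,
      ENNReal.ofReal (t ^ (-3 / 4 : ℝ)) * (ENNReal.ofReal (t ^ (3 / 4 : ℝ)) * f t) := by
    refine setLIntegral_congr_fun measurableSet_Ioi fun t ht => ?_
    have ht0 : 0 < t := hr.trans ht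
    rw [← mul_assoc, ← ENNReal.ofReal_mul (by positivity), ← Real.rpow_add ht0]
    norm_num
  rw [hsplit]
  refine (sq_lintegral_mul_le _ (by fun_prop) (by fun_prop)).trans_eq ?_
  congr 1
  · rw [← show r ^ (-3 / 2 + 1 : ℝ) / (-(-3 / 2) - 1) = 2 * r ^ (-1 / 2 : ℝ) by norm_num; ring,
      ← lintegral_rpow_Ioi (by norm_num) hr]
    refine setLIntegral_congr_fun measurableSet_Ioi fun t ht => ?_
    have ht0 : 0 < t := hr.trans ht
    rw [← ENNReal.ofReal_pow (by positivity), ← Real.rpow_mul_natCast ht0.le]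
    norm_num
  · refine setLIntegral_congr_fun measurableSet_Ioi fun t ht => ?_
    have ht0 : 0 < t := hr.trans ht
    rw [mul_pow, ← ENNReal.ofReal_pow (by positivity), ← Real.rpow_mul_natCast ht0.le]
    norm_num

/-- Hardy's inequality. -/
lemma lintegral_sq_lintegral_Ioi_le {f : ℝ → ℝ≥0∞}
    (hf : AEMeasurable f (volume.restrict (Ioi 0))) :
    ∫⁻ r in Ioi (0 : ℝ), (∫⁻ t in Ioi r, f t) ^ 2 ≤
      4 * ∫⁻ t in Ioi (0 : ℝ), ENNReal.ofReal (t ^ 2) * f t ^ 2 := by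
  set F : ℝ → ℝ≥0∞ := fun t => ENNReal.ofReal (t ^ (3 / 2 : ℝ)) * f t ^ 2
  have hF : AEMeasurable F (volume.restrict (Ioi 0)) := by fun_prop
  have hpt : ∀ r ∈ Ioi (0 : ℝ), (∫⁻ t in Ioi r, f t) ^ 2 ≤
      ENNReal.ofReal (2 * r ^ (-1 / 2 : ℝ)) * ∫⁻ t in Ioi r, F t := fun r (hr : 0 < r) =>
    sq_lintegral_Ioi_le hr (hf.mono_measure (Measure.restrict_mono (Ioi_subset_Ioi hr.le) le_rfl))
  refine (setLIntegral_mono' measurableSet_Ioi hpt).trans_eq ?_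
  rw [lintegral_mul_lintegral_Ioi_eq 0 (by fun_prop) hF, ← lintegral_const_mul'' _ (by fun_prop)]
  refine setLIntegral_congr_fun measurableSet_Ioi fun t (ht : 0 < t) => ?_
  have hinner : ∫⁻ r in Ioo 0 t, ENNReal.ofReal (2 * r ^ (-1 / 2 : ℝ)) =
      ENNReal.ofReal (4 * t ^ (1 / 2 : ℝ)) := by
    have h4 : 2 * (t ^ (-1 / 2 + 1 : ℝ) / (-1 / 2 + 1)) = 4 * t ^ (1 / 2 : ℝ) := by
      norm_num
      ring
    rw [← h4, ENNReal.ofReal_mul zero_le_two, ← lintegral_rpow_Ioo (by norm_num) ht.le,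
      ← lintegral_const_mul _ (by fun_prop)]
    simp_rw [ENNReal.ofReal_mul (zero_le_two (α := ℝ))]
  have hpow : t ^ (3 / 2 : ℝ) * (4 * t ^ (1 / 2 : ℝ)) = 4 * t ^ 2 := by
    rw [mul_left_comm, ← Real.rpow_add ht]
    norm_num
  rw [hinner, mul_right_comm, ← ENNReal.ofReal_mul (by positivity), hpow,
    ENNReal.ofReal_mul (by norm_num), mul_assoc, ENNReal.ofReal_ofNat]

lemma lintegral_fin_prod_eq_prod {α : Type*} [MeasurableSpace α] {n : ℕ}
    {μ : Fin n → Measure α} [∀ i, SigmaFinite (μ i)] {f : Fin n → α → ℝ≥0∞}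
    (hf : ∀ i, Measurable (f i)) :
    ∫⁻ x, ∏ i, f i (x i) ∂Measure.pi μ = ∏ i, ∫⁻ a, f i a ∂μ i := by
  induction n with
  | zero => simp
  | succ n ih =>
    have hsplit : ∫⁻ x, ∏ i, f i (x i) ∂Measure.pi μ =
        ∫⁻ x : α × (Fin n → α), f 0 x.1 * ∏ i, f i.succ (x.2 i)
          ∂(μ 0).prod (Measure.pi fun i => μ i.succ) := by
      simp only [Fin.prod_univ_succ]
      exact (measurePreserving_piFinSuccAbove μ 0).lintegral_comp_emb
        (MeasurableEquiv.measurableEmbedding _)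
        (fun x : α × (Fin n → α) => f 0 x.1 * ∏ i, f i.succ (x.2 i))
    have htail : Measurable fun x : Fin n → α => ∏ i, f i.succ (x i) :=
      Finset.measurable_prod _ fun i _ => (hf i.succ).comp (measurable_pi_apply i)
    rw [hsplit, lintegral_prod_mul (hf 0).aemeasurable htail.aemeasurable,
      ih fun i => hf i.succ, Fin.prod_univ_succ]

end Integrals

section Polar

/-- The radial part `t ^ n dt` on `(0, ∞)` of a Haar measure in dimension `n + 1`: the image of
`Measure.volumeIoiPow n` on the line, which spares the passage to a subtype. -/
noncomputable def radialMeasure (n : ℕ) : Measure ℝ :=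
  (volume.restrict (Ioi 0)).withDensity fun t => ENNReal.ofReal (t ^ n)

instance (n : ℕ) : SFinite (radialMeasure n) := by
  rw [radialMeasure]
  infer_instance

lemma measurePreserving_val_radialMeasure (n : ℕ) :
    MeasurePreserving Subtype.val (Measure.volumeIoiPow n) (radialMeasure n) := by
  refine ⟨measurable_subtype_coe, Measure.ext fun s hs => ?_⟩
  rw [Measure.map_apply measurable_subtype_coe hs, Measure.volumeIoiPow, radialMeasure,
    withDensity_apply _ (measurable_subtype_coe hs), withDensity_apply _ hs,
    setLIntegral_subtype measurableSet_Ioi _ fun t : ℝ => ENNReal.ofReal (t ^ n),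
    Subtype.image_preimage_coe, Measure.restrict_restrict hs, inter_comm]

lemma lintegral_radialMeasure (n : ℕ) {f : ℝ → ℝ≥0∞}
    (hf : AEMeasurable f (volume.restrict (Ioi 0))) :
    ∫⁻ t, f t ∂radialMeasure n = ∫⁻ t in Ioi (0 : ℝ), ENNReal.ofReal (t ^ n) * f t :=
  lintegral_withDensity_eq_lintegral_mul₀ (by fun_prop) hf

lemma ae_radialMeasure_iff (n : ℕ) {p : ℝ → Prop} :
    (∀ᵐ t ∂radialMeasure n, p t) ↔ ∀ᵐ t ∂volume.restrict (Ioi 0), p t := by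
  rw [radialMeasure, ae_withDensity_iff (by fun_prop)]
  refine ⟨fun h => ?_, fun h => h.mono fun _ ht _ => ht⟩
  filter_upwards [h, ae_restrict_mem measurableSet_Ioi] with t ht h0
  exact ht (by simpa using pow_pos h0 n)

lemma integrable_radialMeasure_iff (n : ℕ) {f : ℝ → ℝ} :
    Integrable f (radialMeasure n) ↔ IntegrableOn (fun t => t ^ n * f t) (Ioi 0) := by
  rw [radialMeasure, integrable_withDensity_iff_integrable_smul' (by fun_prop) (by simp)]
  refine integrable_congr ?_
  filter_upwards [ae_restrict_mem measurableSet_Ioi] with t ht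
  rw [ENNReal.toReal_ofReal (pow_nonneg (le_of_lt ht) n), smul_eq_mul]

lemma integral_radialMeasure (n : ℕ) (f : ℝ → ℝ) :
    ∫ t, f t ∂radialMeasure n = ∫ t in Ioi (0 : ℝ), t ^ n * f t := by
  rw [radialMeasure, integral_withDensity_eq_integral_toReal_smul (by fun_prop) (by simp)]
  refine setIntegral_congr_fun measurableSet_Ioi fun t ht => ?_
  rw [ENNReal.toReal_ofReal (pow_nonneg (le_of_lt ht) n), smul_eq_mul]

lemma norm_smul_sphere {E : Type*} [NormedAddCommGroup E] [NormedSpace ℝ E] {t : ℝ} (ht : 0 < t)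
    (θ : sphere (0 : E) 1) : ‖t • (θ : E)‖ = t := by
  rw [norm_smul, norm_eq_of_mem_sphere, mul_one, Real.norm_of_nonneg ht.le]

lemma integrable_mul_comp_norm {E : Type*} [NormedAddCommGroup E] [ProperSpace E]
    [MeasurableSpace E] [BorelSpace E] {μ : Measure E} {f : E → ℝ}
    (hf : LocallyIntegrable f μ) {q : ℝ → ℝ}
    (hq : Measurable q) {C b : ℝ} (hC : ∀ t, ‖q t‖ ≤ C) (hb : ∀ t, b < t → q t = 0) :
    Integrable (fun x => f x * q ‖x‖) μ := by
  have hball : IntegrableOn (fun x => f x * q ‖x‖) (closedBall 0 b) μ :=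
    (hf.integrableOn_isCompact (isCompact_closedBall 0 b)).mul_bdd (c := C)
      (hq.comp measurable_norm).aestronglyMeasurable (ae_of_all _ fun x => hC _)
  refine (integrableOn_iff_integrable_of_support_subset fun x hx => ?_).1 hball
  by_contra hxb
  exact hx (mul_eq_zero_of_right _ (hb _ (by simpa using hxb)))

variable {E : Type*} [NormedAddCommGroup E] [NormedSpace ℝ E] [FiniteDimensional ℝ E]
  [Nontrivial E] [MeasurableSpace E] [BorelSpace E] (μ : Measure E) [μ.IsAddHaarMeasure]

lemma measurePreserving_smul_sphere :
    MeasurePreserving (fun z : ℝ × sphere (0 : E) 1 => z.1 • (z.2 : E))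
      ((radialMeasure (Module.finrank ℝ E - 1)).prod μ.toSphere) μ := by
  have hfst := (measurePreserving_val_radialMeasure (Module.finrank ℝ E - 1)).prod
    (.id μ.toSphere) |>.comp Measure.measurePreserving_swap
  have hinv := μ.measurePreserving_homeomorphUnitSphereProd.symm
    (homeomorphUnitSphereProd E).toMeasurableEquiv
  have hval := measurePreserving_subtype_coe (μa := μ) (measurableSet_singleton (0 : E)).compl
  rw [restrict_compl_singleton] at hval
  have hcomp := hval.comp hinv
  refine ⟨by fun_prop, ?_⟩
  rw [← hfst.map_eq, Measure.map_map (by fun_prop) hfst.measurable]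
  exact hcomp.map_eq

lemma lintegral_eq_lintegral_sphere {f : E → ℝ≥0∞} (hf : AEMeasurable f μ) :
    ∫⁻ x, f x ∂μ = ∫⁻ t, ∫⁻ θ, f (t • (θ : E)) ∂μ.toSphere
      ∂radialMeasure (Module.finrank ℝ E - 1) := by
  have hmp := measurePreserving_smul_sphere μ
  have hprod := lintegral_prod _ (hf.comp_quasiMeasurePreserving hmp.quasiMeasurePreserving)
  rw [← hmp.map_eq] at hf
  exact (hmp.map_eq ▸ lintegral_map' hf hmp.aemeasurable).trans hprod

lemma lintegral_comp_norm {f : ℝ → ℝ≥0∞} (hf : Measurable f) :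
    ∫⁻ x, f ‖x‖ ∂μ = μ.toSphere univ * ∫⁻ t in Ioi (0 : ℝ),
      ENNReal.ofReal (t ^ (Module.finrank ℝ E - 1)) * f t := by
  rw [lintegral_eq_lintegral_sphere μ (by fun_prop), ← lintegral_radialMeasure _ hf.aemeasurable,
    ← lintegral_const_mul _ hf]
  refine lintegral_congr_ae ((ae_radialMeasure_iff _).2 ?_)
  filter_upwards [ae_restrict_mem measurableSet_Ioi] with t ht
  simp only [norm_smul_sphere ht, lintegral_const, mul_comm]

lemma quasiMeasurePreserving_norm : Measure.QuasiMeasurePreserving (norm : E → ℝ) μ volume := by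
  refine ⟨measurable_norm, Measure.AbsolutelyContinuous.mk fun s hs h0 => ?_⟩
  rw [Measure.map_apply measurable_norm hs, ← lintegral_indicator_one (measurable_norm hs)]
  refine (lintegral_comp_norm μ (measurable_one.indicator hs)).trans (mul_eq_zero_of_right _ ?_)
  refine lintegral_eq_zero_of_ae_eq_zero (ae_restrict_of_ae ?_)
  filter_upwards [measure_eq_zero_iff_ae_notMem.1 h0] with t ht
  simp [ht]

lemma ae_comp_norm {p : ℝ → Prop} (h : ∀ᵐ t ∂volume.restrict (Ioi 0), p t) : ∀ᵐ x ∂μ, p ‖x‖ := by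
  filter_upwards [(quasiMeasurePreserving_norm μ).ae ((ae_restrict_iff' measurableSet_Ioi).1 h),
    compl_mem_ae_iff.2 (measure_singleton (0 : E))] with x hx hx0 using hx (norm_pos_iff.2 hx0)

lemma setLIntegral_comp_norm {f : ℝ → ℝ≥0∞} (hf : AEMeasurable f (volume.restrict (Ioi 0)))
    {s : Set ℝ} (hs : MeasurableSet s) :
    ∫⁻ x in norm ⁻¹' s, f ‖x‖ ∂μ = μ.toSphere univ * ∫⁻ t in s ∩ Ioi 0,
      ENNReal.ofReal (t ^ (Module.finrank ℝ E - 1)) * f t := by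
  have hcongr : ∫⁻ x in norm ⁻¹' s, f ‖x‖ ∂μ = ∫⁻ x, s.indicator (hf.mk f) ‖x‖ ∂μ := by
    rw [← lintegral_indicator (measurable_norm hs)]
    refine lintegral_congr_ae ?_
    filter_upwards [ae_comp_norm μ hf.ae_eq_mk] with x hx
    simp only [indicator, hx]
    rfl
  rw [hcongr, lintegral_comp_norm μ (hf.measurable_mk.indicator hs), ← Measure.restrict_restrict hs,
    ← lintegral_indicator hs]
  congr 1
  refine lintegral_congr_ae ?_
  filter_upwards [hf.ae_eq_mk] with t ht
  simp only [indicator, ht, mul_ite, mul_zero]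

lemma ae_ae_sphere {p : E → Prop} (h : ∀ᵐ x ∂μ, p x) :
    ∀ᵐ t : ℝ ∂volume.restrict (Ioi 0), ∀ᵐ θ : sphere (0 : E) 1 ∂μ.toSphere, p (t • (θ : E)) :=
  (ae_radialMeasure_iff _).1 <|
    Measure.ae_ae_of_ae_prod ((measurePreserving_smul_sphere μ).quasiMeasurePreserving.ae h)

/-- The mean of `f` over the sphere of radius `t`. -/
noncomputable def sphericalMean (f : E → ℝ) (t : ℝ) : ℝ := ⨍ θ, f (t • (θ : E)) ∂μ.toSphere

variable {μ} {f : E → ℝ}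

lemma sphericalMean_ae_eq {w : ℝ → ℝ} (h : ∀ᵐ x ∂μ, f x = w ‖x‖) :
    ∀ᵐ t ∂volume.restrict (Ioi 0), sphericalMean μ f t = w t := by
  have : NeZero μ.toSphere := ⟨μ.toSphere_ne_zero⟩
  filter_upwards [ae_ae_sphere μ h, ae_restrict_mem measurableSet_Ioi] with t ht h0
  rw [sphericalMean, average_congr (g := fun _ => w t), average_const]
  filter_upwards [ht] with θ hθ
  rw [hθ, norm_smul_sphere h0]

lemma integrable_smul_sphere {q : ℝ → ℝ} (hf : Integrable (fun x => f x * q ‖x‖) μ) :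
    Integrable (fun z : ℝ × sphere (0 : E) 1 => f (z.1 • (z.2 : E)) * q z.1)
      ((radialMeasure (Module.finrank ℝ E - 1)).prod μ.toSphere) := by
  refine ((measurePreserving_smul_sphere μ).integrable_comp_of_integrable hf).congr ?_
  have h0 : ∀ᵐ t ∂radialMeasure (Module.finrank ℝ E - 1), 0 < t :=
    (ae_radialMeasure_iff _).2 (ae_restrict_mem measurableSet_Ioi)
  filter_upwards [Measure.quasiMeasurePreserving_fst.ae h0] with z hz
  simp only [Function.comp_apply, norm_smul_sphere hz]

lemma integrableOn_sphericalMean_mul {q : ℝ → ℝ} (hf : Integrable (fun x => f x * q ‖x‖) μ) :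
    IntegrableOn (fun t => t ^ (Module.finrank ℝ E - 1) * (sphericalMean μ f t * q t))
      (Ioi 0) := by
  have h := (integrable_smul_sphere hf).integral_prod_left.const_mul (μ.toSphere.real univ)⁻¹
  refine (integrable_radialMeasure_iff _).1 (h.congr (ae_of_all _ fun t => ?_))
  simp only [integral_mul_const, ← mul_assoc, sphericalMean, average_eq, smul_eq_mul]

lemma integral_mul_comp_norm {q : ℝ → ℝ} (hf : Integrable (fun x => f x * q ‖x‖) μ) :
    ∫ x, f x * q ‖x‖ ∂μ = μ.toSphere.real univ * ∫ t in Ioi (0 : ℝ),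
      t ^ (Module.finrank ℝ E - 1) * (sphericalMean μ f t * q t) := by
  have hmp := measurePreserving_smul_sphere μ
  have hm := hf.aestronglyMeasurable
  have hprod := integral_prod _ (hmp.integrable_comp_of_integrable hf)
  rw [← hmp.map_eq] at hm
  have hmap := hmp.map_eq ▸ integral_map hmp.aemeasurable hm
  rw [← integral_radialMeasure, ← integral_const_mul]
  refine hmap.trans (hprod.trans (integral_congr_ae ((ae_radialMeasure_iff _).2 ?_)))
  filter_upwards [ae_restrict_mem measurableSet_Ioi] with t ht
  have hmean := measure_smul_average μ.toSphere fun θ => f (t • (θ : E))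
  rw [smul_eq_mul] at hmean
  simp only [Function.comp_apply, norm_smul_sphere ht, integral_mul_const, ← mul_assoc,
    sphericalMean, hmean]

lemma locallyIntegrableOn_sphericalMean (hf : LocallyIntegrable f μ) :
    LocallyIntegrableOn (sphericalMean μ f) (Ioi 0) := by
  rw [locallyIntegrableOn_iff isOpen_Ioi.isLocallyClosed]
  intro K hK hKc
  set n := Module.finrank ℝ E - 1
  set q : ℝ → ℝ := K.indicator fun t => (t ^ n)⁻¹ with hq
  obtain ⟨b, hb⟩ := hKc.isBounded.subset_closedBall 0
  have hqc : ContinuousOn (fun t : ℝ => (t ^ n)⁻¹) K :=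
    (continuous_pow _).continuousOn.inv₀ fun t ht => (pow_pos (hK ht) _).ne'
  obtain ⟨C, hC⟩ := hKc.exists_bound_of_continuousOn hqc
  have hint : Integrable (fun x => f x * q ‖x‖) μ := by
    refine integrable_mul_comp_norm hf (Measurable.indicator (by fun_prop) hKc.measurableSet)
      (C := max C 0) (b := b) (fun t => ?_) fun t ht => indicator_of_notMem (fun htK => ?_) _
    · by_cases ht : t ∈ K
      · simpa only [hq, indicator_of_mem ht] using (hC t ht).trans (le_max_left _ _)
      · simp [hq, ht]
    · exact ht.not_ge ((le_abs_self t).trans (by simpa using hb htK))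
  refine ((integrableOn_sphericalMean_mul hint).mono_set hK).congr_fun (fun t ht => ?_)
    hKc.measurableSet
  have htn : t ^ n ≠ 0 := (pow_pos (hK ht) n).ne'
  simp only [hq, indicator_of_mem ht]
  rw [mul_left_comm, mul_inv_cancel₀ htn, mul_one]

lemma aemeasurable_of_ae_eq_comp_norm (hf : LocallyIntegrable f μ) {w : ℝ → ℝ}
    (h : ∀ᵐ x ∂μ, f x = w ‖x‖) : AEMeasurable w (volume.restrict (Ioi 0)) :=
  (locallyIntegrableOn_sphericalMean hf).aestronglyMeasurable.aemeasurable.congr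
    (sphericalMean_ae_eq h)

lemma enorm_sphericalMean_sq_le {t : ℝ}
    (hf : AEStronglyMeasurable (fun θ : sphere (0 : E) 1 => f (t • (θ : E))) μ.toSphere) :
    μ.toSphere univ * ‖sphericalMean μ f t‖ₑ ^ 2 ≤ ∫⁻ θ, ‖f (t • (θ : E))‖ₑ ^ 2 ∂μ.toSphere := by
  have hσ0 : μ.toSphere univ ≠ 0 := Measure.measure_univ_ne_zero.2 μ.toSphere_ne_zero
  have hσ : μ.toSphere univ ≠ ⊤ := measure_ne_top _ _
  have hmean : μ.toSphere univ * ‖sphericalMean μ f t‖ₑ ≤ ∫⁻ θ, ‖f (t • (θ : E))‖ₑ ∂μ.toSphere := by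
    rw [← ENNReal.ofReal_toReal hσ, ← Real.enorm_of_nonneg ENNReal.toReal_nonneg, ← enorm_mul,
      ← measureReal_def, ← smul_eq_mul, sphericalMean, measure_smul_average]
    exact enorm_integral_le_lintegral_enorm _
  have hcs := sq_lintegral_mul_le μ.toSphere hf.enorm (aemeasurable_const (b := 1))
  simp only [mul_one, one_pow, lintegral_const, one_mul] at hcs
  refine (ENNReal.mul_le_mul_iff_right hσ0 hσ).1 ?_
  calc μ.toSphere univ * (μ.toSphere univ * ‖sphericalMean μ f t‖ₑ ^ 2)
      = (μ.toSphere univ * ‖sphericalMean μ f t‖ₑ) ^ 2 := by ring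
    _ ≤ (∫⁻ θ, ‖f (t • (θ : E))‖ₑ ∂μ.toSphere) ^ 2 := by gcongr
    _ ≤ _ := hcs.trans_eq (mul_comm _ _)

lemma lintegral_enorm_sphericalMean_sq_le (hf : AEStronglyMeasurable f μ) :
    μ.toSphere univ * ∫⁻ t in Ioi (0 : ℝ), ENNReal.ofReal (t ^ (Module.finrank ℝ E - 1)) *
      ‖sphericalMean μ f t‖ₑ ^ 2 ≤ ∫⁻ x, ‖f x‖ₑ ^ 2 ∂μ := by
  have hm := hf.comp_measurePreserving (measurePreserving_smul_sphere μ)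
  rw [lintegral_eq_lintegral_sphere μ (by fun_prop)]
  calc _ ≤ μ.toSphere univ * ∫⁻ t, ‖sphericalMean μ f t‖ₑ ^ 2
        ∂radialMeasure (Module.finrank ℝ E - 1) := by
        rw [radialMeasure, lintegral_withDensity_eq_lintegral_mul_non_measurable _ (by fun_prop)
          (by simp)]
        rfl
    _ ≤ ∫⁻ t, μ.toSphere univ * ‖sphericalMean μ f t‖ₑ ^ 2
        ∂radialMeasure (Module.finrank ℝ E - 1) := lintegral_const_mul_le _ _
    _ ≤ _ := lintegral_mono_ae (hm.prodMk_left.mono fun t ht => enorm_sphericalMean_sq_le ht)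

end Polar

section DuBoisReymond

variable {s : Set ℝ} {f φ : ℝ → ℝ} {a : ℝ}

lemma integrable_mul_of_tsupport_subset (hf : LocallyIntegrableOn f s) (hφ : Continuous φ)
    (hφc : HasCompactSupport φ) (hφs : tsupport φ ⊆ s) : Integrable fun t => f t * φ t := by
  have hon : IntegrableOn (fun t => f t * φ t) (tsupport φ) :=
    (hf.integrableOn_compact_subset hφs hφc).mul_continuousOn hφ.continuousOn hφc
  refine (integrableOn_iff_integrable_of_support_subset fun t ht => ?_).1 hon
  exact subset_tsupport φ (right_ne_zero_of_mul ht)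

lemma exists_subset_Icc_subset [s.OrdConnected] {K : Set ℝ} (hK : IsCompact K) (hKs : K ⊆ s)
    (ha : a ∈ s) : ∃ c d, K ⊆ Icc c d ∧ a ∈ Icc c d ∧ Icc c d ⊆ s := by
  have hKa : IsCompact (insert a K) := hK.insert a
  obtain ⟨c, hc⟩ := hKa.exists_isLeast (insert_nonempty a K)
  obtain ⟨d, hd⟩ := hKa.exists_isGreatest (insert_nonempty a K)
  have hsub : insert a K ⊆ s := insert_subset ha hKs
  exact ⟨c, d, fun t ht => ⟨hc.2 (mem_insert_of_mem a ht), hd.2 (mem_insert_of_mem a ht)⟩,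
    ⟨hc.2 (mem_insert a K), hd.2 (mem_insert a K)⟩,
    Set.Icc_subset s (hsub hc.1) (hsub hd.1)⟩

lemma integral_eq_intervalIntegral_of_subset_Icc {c d : ℝ} (hcd : c ≤ d)
    (hf : ∀ t, t ∉ Icc c d → f t = 0) : ∫ t, f t = ∫ t in c..d, f t := by
  rw [intervalIntegral.integral_of_le hcd, ← integral_Icc_eq_integral_Ioc,
    setIntegral_eq_integral_of_forall_compl_eq_zero hf]

lemma exists_deriv_eq_of_integral_eq_zero [s.OrdConnected] (ha : a ∈ s) (hφ : ContDiff ℝ ∞ φ)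
    (hφc : HasCompactSupport φ) (hφs : tsupport φ ⊆ s) (hφ0 : ∫ t, φ t = 0) :
    ∃ η : ℝ → ℝ, ContDiff ℝ ∞ η ∧ HasCompactSupport η ∧ tsupport η ⊆ s ∧ deriv η = φ := by
  obtain ⟨c, d, hsupp, -, hcds⟩ := exists_subset_Icc_subset hφc hφs ha
  have hzero (t : ℝ) (ht : t ∉ Icc c d) : φ t = 0 :=
    image_eq_zero_of_notMem_tsupport fun h => ht (hsupp h)
  have hderiv (t : ℝ) : HasDerivAt (fun t => ∫ r in c..t, φ r) (φ t) t :=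
    (hφ.continuous.integral_hasStrictDerivAt c t).hasDerivAt
  have hderiv_eq : deriv (fun t => ∫ r in c..t, φ r) = φ := funext fun t => (hderiv t).deriv
  have hsub : tsupport (fun t => ∫ r in c..t, φ r) ⊆ Icc c d := by
    refine closure_minimal (fun t ht => ?_) isClosed_Icc
    by_contra hout
    refine ht (show ∫ r in c..t, φ r = 0 from ?_)
    rcases lt_or_ge t c with htc | hct
    · rw [intervalIntegral.integral_symm, intervalIntegral.integral_of_le htc.le,
        integral_Ioc_eq_integral_Ioo, setIntegral_eq_zero_of_forall_eq_zero, neg_zero]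
      exact fun r hr => hzero r fun h => hr.2.not_ge h.1
    · have hdt : d < t := not_le.1 fun h => hout ⟨hct, h⟩
      rw [← integral_eq_intervalIntegral_of_subset_Icc hct, hφ0]
      exact fun r hr => hzero r fun h => hr ⟨h.1, h.2.trans hdt.le⟩
  refine ⟨fun t => ∫ r in c..t, φ r, contDiff_infty_iff_deriv.2 ⟨fun t =>
    (hderiv t).differentiableAt, hderiv_eq.symm ▸ hφ⟩, ?_, hsub.trans hcds, hderiv_eq⟩
  exact isCompact_Icc.of_isClosed_subset (isClosed_tsupport _) hsub

lemma integral_primitive_mul_deriv [s.OrdConnected] (ha : a ∈ s) (hf : LocallyIntegrableOn f s)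
    (hφ : ContDiff ℝ 1 φ) (hφc : HasCompactSupport φ) (hφs : tsupport φ ⊆ s) :
    ∫ t, (∫ r in a..t, f r) * deriv φ t = -∫ t, f t * φ t := by
  obtain ⟨c, d, hsupp, hacd, hcds⟩ := exists_subset_Icc_subset hφc hφs ha
  have hcd : c ≤ d := hacd.1.trans hacd.2
  rw [← uIcc_of_le hcd] at hacd
  have hint : IntervalIntegrable f volume c d :=
    (intervalIntegrable_iff_integrableOn_Icc_of_le hcd).2
      (hf.integrableOn_compact_subset hcds isCompact_Icc)
  have hprim := hint.absolutelyContinuousOnInterval_intervalIntegral hacd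
  have hzero {η : ℝ → ℝ} (hη : tsupport η ⊆ tsupport φ) (F : ℝ → ℝ) :
      ∫ t, F t * η t = ∫ t in c..d, F t * η t :=
    integral_eq_intervalIntegral_of_subset_Icc hcd fun t ht => mul_eq_zero_of_right _
      (image_eq_zero_of_notMem_tsupport fun h => ht (hsupp (hη h)))
  have hderiv : ∫ t in c..d, deriv (fun t => ∫ r in a..t, f r) t * φ t = ∫ t in c..d, f t * φ t :=
    intervalIntegral.integral_congr_ae <| hint.ae_hasDerivAt_integral.mono fun t ht htcd => by
      rw [(ht (uIoc_subset_uIcc htcd) a hacd).deriv]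
  have hbdry (t : ℝ) (ht : t ∉ Ioo c d) : φ t = 0 := by
    have hopen := hφ.continuous.isOpen_support.subset_interior_iff.2
      ((subset_tsupport φ).trans hsupp)
    rw [interior_Icc] at hopen
    exact Function.notMem_support.1 fun h => ht (hopen h)
  rw [hzero (tsupport_deriv_subset (f := φ)), hzero subset_rfl,
    hprim.integral_mul_deriv_eq_deriv_mul hφ.contDiffOn.absolutelyContinuousOnInterval, hderiv,
    hbdry c fun h => h.1.false, hbdry d fun h => h.2.false]
  ring

lemma locallyIntegrableOn_primitive [s.OrdConnected] (hs : IsOpen s) (ha : a ∈ s)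
    (hf : LocallyIntegrableOn f s) : LocallyIntegrableOn (fun t => ∫ r in a..t, f r) s := by
  refine (locallyIntegrableOn_iff hs.isLocallyClosed).2 fun K hKs hK => ?_
  obtain ⟨c, d, hKcd, hacd, hcds⟩ := exists_subset_Icc_subset hK hKs ha
  have hcd := uIcc_of_le (hacd.1.trans hacd.2)
  have hint : IntegrableOn f (uIcc c d) :=
    hf.integrableOn_compact_subset (hcd ▸ hcds) isCompact_uIcc
  have hcont := intervalIntegral.continuousOn_primitive_interval' hint.intervalIntegrable
    (hcd.symm ▸ hacd)
  exact (hcont.integrableOn_compact isCompact_uIcc).mono_set (hcd.symm ▸ hKcd)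

lemma exists_ae_eq_const_of_integral_mul_deriv_eq_zero [s.OrdConnected] (hs : IsOpen s)
    (ha : a ∈ s) (hf : LocallyIntegrableOn f s)
    (hderiv : ∀ η : ℝ → ℝ, ContDiff ℝ ∞ η → HasCompactSupport η → tsupport η ⊆ s →
      ∫ t, f t * deriv η t = 0) :
    ∃ c, ∀ᵐ t, t ∈ s → f t = c := by
  obtain ⟨ε, hε, hball⟩ := nhds_basis_closedBall.mem_iff.1 (hs.mem_nhds ha)
  let bump : ContDiffBump a := ⟨ε / 2, ε, half_pos hε, half_lt_self hε⟩
  set ψ := bump.normed volume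
  have hψ : ContDiff ℝ ∞ ψ := bump.contDiff_normed
  have hψc : HasCompactSupport ψ := bump.hasCompactSupport_normed
  have hψs : tsupport ψ ⊆ s := bump.tsupport_normed_eq.trans_subset hball
  refine ⟨∫ t, f t * ψ t, ?_⟩
  have hzero : ∀ᵐ t, t ∈ s → f t - ∫ t, f t * ψ t = 0 := by
    refine hs.ae_eq_zero_of_integral_contDiff_smul_eq_zero
      (hf.sub (locallyIntegrableOn_const _)) fun φ hφ hφc hφs => ?_
    have hφψ : ContDiff ℝ ∞ fun t => φ t - (∫ r, φ r) * ψ t := hφ.sub (contDiff_const.mul hψ)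
    have hφψc : HasCompactSupport fun t => φ t - (∫ r, φ r) * ψ t := hφc.sub hψc.mul_left
    obtain ⟨η, hη, hηc, hηs, hη'⟩ := exists_deriv_eq_of_integral_eq_zero ha hφψ hφψc
      ((tsupport_sub φ _).trans (union_subset hφs ((tsupport_mul_subset_right).trans hψs)))
      (by rw [integral_sub (hφ.continuous.integrable_of_hasCompactSupport hφc)
            ((hψ.continuous.integrable_of_hasCompactSupport hψc).const_mul _),
          integral_const_mul, bump.integral_normed, mul_one, sub_self])
    have hfφ := integrable_mul_of_tsupport_subset hf hφ.continuous hφc hφs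
    have hfψ := integrable_mul_of_tsupport_subset hf hψ.continuous hψc hψs
    calc ∫ t, φ t • (f t - ∫ r, f r * ψ r)
        = (∫ t, f t * φ t) - ∫ t, φ t * ∫ r, f r * ψ r := by
          rw [← integral_sub hfφ ((hφ.continuous.integrable_of_hasCompactSupport hφc).mul_const _)]
          congr with t
          rw [smul_eq_mul]
          ring
      _ = ∫ t, f t * deriv η t := by
          rw [integral_mul_const, ← integral_const_mul, ← integral_sub hfφ (hfψ.const_mul _), hη']
          congr with t
          ring
      _ = 0 := hderiv η hη hηc hηs
  exact hzero.mono fun t ht hts => sub_eq_zero.1 (ht hts)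

/-- The du Bois-Reymond lemma. -/
lemma exists_ae_eq_add_primitive [s.OrdConnected] (hs : IsOpen s) (ha : a ∈ s) {w h : ℝ → ℝ}
    (hw : LocallyIntegrableOn w s) (hh : LocallyIntegrableOn h s)
    (hwh : ∀ η : ℝ → ℝ, ContDiff ℝ ∞ η → HasCompactSupport η → tsupport η ⊆ s →
      ∫ t, w t * deriv η t = -∫ t, h t * η t) :
    ∃ c, ∀ᵐ t, t ∈ s → w t = c + ∫ r in a..t, h r := by
  have hprim := locallyIntegrableOn_primitive hs ha hh
  obtain ⟨c, hc⟩ := exists_ae_eq_const_of_integral_mul_deriv_eq_zero hs ha (hw.sub hprim)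
    fun η hη hηc hηs => by
      have hη' := hη.continuous_deriv (by norm_num)
      have hηs' := (tsupport_deriv_subset (f := η)).trans hηs
      simp only [Pi.sub_apply, sub_mul]
      rw [integral_sub (integrable_mul_of_tsupport_subset hw hη' hηc.deriv hηs')
        (integrable_mul_of_tsupport_subset hprim hη' hηc.deriv hηs'), hwh η hη hηc hηs,
        integral_primitive_mul_deriv ha hh (hη.of_le (by norm_num)) hηc hηs, sub_self]
  exact ⟨c, hc.mono fun t ht hts => sub_eq_iff_eq_add.1 (ht hts)⟩

end DuBoisReymond

lemma integrable_mul_of_hasCompactSupport {X : Type*} [TopologicalSpace X] [T2Space X]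
    [MeasurableSpace X] [OpensMeasurableSpace X] {μ : Measure X} {f φ : X → ℝ}
    (hf : LocallyIntegrable f μ) (hφ : Continuous φ) (hφc : HasCompactSupport φ) :
    Integrable (fun x => f x * φ x) μ :=
  (hf.integrable_smul_left_of_hasCompactSupport hφ hφc).congr
    (ae_of_all _ fun x => mul_comm (φ x) (f x))

section RadialDerivative

variable {E : Type*} [NormedAddCommGroup E] [InnerProductSpace ℝ E]

lemma contDiff_comp_norm {k : WithTop ℕ∞} {q : ℝ → ℝ} (hq : ContDiff ℝ k q)
    (hq0 : 0 ∉ tsupport q) : ContDiff ℝ k fun x : E => q ‖x‖ := by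
  refine contDiff_iff_contDiffAt.2 fun x => ?_
  rcases eq_or_ne x 0 with rfl | hx
  · refine (contDiffAt_const (c := (0 : ℝ))).congr_of_eventuallyEq ?_
    exact (tendsto_norm_zero (E := E)).eventually (notMem_tsupport_iff_eventuallyEq.1 hq0)
  · exact hq.contDiffAt.comp x (contDiffAt_norm ℝ hx)

lemma hasCompactSupport_comp_norm [FiniteDimensional ℝ E] {q : ℝ → ℝ} (hq : HasCompactSupport q) :
    HasCompactSupport fun x : E => q ‖x‖ := by
  obtain ⟨b, hb⟩ := hq.isCompact.isBounded.subset_closedBall 0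
  refine .of_support_subset_isCompact (isCompact_closedBall 0 b) fun x hx => ?_
  simpa using hb (subset_tsupport q hx)

lemma hasCompactSupport_div_pow {η : ℝ → ℝ} (hη : HasCompactSupport η) (n : ℕ) :
    HasCompactSupport fun t => η t / t ^ n := by
  simpa only [div_eq_mul_inv] using! hη.mul_right

lemma tsupport_div_pow_subset (η : ℝ → ℝ) (n : ℕ) :
    tsupport (fun t => η t / t ^ n) ⊆ tsupport η := by
  simpa only [div_eq_mul_inv] using! tsupport_mul_subset_left

lemma contDiff_div_pow {k : WithTop ℕ∞} {η : ℝ → ℝ} (hη : ContDiff ℝ k η) (hη0 : 0 ∉ tsupport η)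
    (n : ℕ) : ContDiff ℝ k fun t => η t / t ^ n := by
  refine contDiff_iff_contDiffAt.2 fun t => ?_
  rcases eq_or_ne t 0 with rfl | ht
  · refine (contDiffAt_const (c := (0 : ℝ))).congr_of_eventuallyEq ?_
    filter_upwards [notMem_tsupport_iff_eventuallyEq.1 hη0] with s hs
    simp [hs]
  · exact hη.contDiffAt.div (contDiffAt_id.pow n) (pow_ne_zero n ht)

lemma hasFDerivAt_comp_norm {q : ℝ → ℝ} {q' : ℝ} {x : E} (hx : x ≠ 0) (hq : HasDerivAt q q' ‖x‖) :
    HasFDerivAt (fun x : E => q ‖x‖) ((q' / ‖x‖) • innerSL ℝ x) x := by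
  have hsqrt := (hasStrictFDerivAt_norm_sq x).hasFDerivAt.sqrt (by positivity)
  simp only [norm_nonneg, Real.sqrt_sq] at hsqrt
  refine (hq.comp_hasFDerivAt x hsqrt).congr_fderiv ?_
  ext y
  simp only [one_div, mul_inv_rev, smul_apply, coe_innerSL_apply, nsmul_eq_mul, Nat.cast_ofNat,
    smul_eq_mul]
  field_simp

lemma fderiv_coord_mul_comp_norm {ι : Type*} [Fintype ι] [DecidableEq ι] {q : ℝ → ℝ} {q' : ℝ}
    {x : EuclideanSpace ℝ ι} (hx : x ≠ 0) (hq : HasDerivAt q q' ‖x‖) (i : ι) :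
    fderiv ℝ (fun x : EuclideanSpace ℝ ι => x i * q ‖x‖) x (EuclideanSpace.single i 1) =
      q ‖x‖ + x i ^ 2 * (q' / ‖x‖) := by
  have hcoord : HasFDerivAt (fun x : EuclideanSpace ℝ ι => x i)
      (EuclideanSpace.proj i : EuclideanSpace ℝ ι →L[ℝ] ℝ) x :=
    (EuclideanSpace.proj i : EuclideanSpace ℝ ι →L[ℝ] ℝ).hasFDerivAt
  rw [(hcoord.fun_mul (hasFDerivAt_comp_norm hx hq)).fderiv]
  simp only [add_apply, smul_apply, coe_innerSL_apply, EuclideanSpace.inner_single_right,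
    Real.ringHom_apply, one_mul, smul_eq_mul, PiLp.proj_apply, PiLp.single_eq_same, mul_one]
  ring

-- The field `x / ‖x‖ ^ n` on `ℝⁿ` is divergence free off the origin.
lemma sum_fderiv_coord_mul_comp_norm {ι : Type*} [Fintype ι] [DecidableEq ι] {η : ℝ → ℝ} {η' : ℝ}
    {x : EuclideanSpace ℝ ι} (hx : x ≠ 0) (hη : HasDerivAt η η' ‖x‖) {n : ℕ}
    (hn : Fintype.card ι = n + 1) :
    ∑ i, fderiv ℝ (fun x : EuclideanSpace ℝ ι => x i * (η ‖x‖ / ‖x‖ ^ (n + 1))) x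
      (EuclideanSpace.single i 1) = η' / ‖x‖ ^ n := by
  have hx0 : ‖x‖ ≠ 0 := norm_ne_zero_iff.2 hx
  have hq := hη.fun_div (hasDerivAt_pow (n + 1) ‖x‖) (pow_ne_zero (n + 1) hx0)
  have hsq : ∑ i, x i ^ 2 = ‖x‖ ^ 2 := by simp [EuclideanSpace.norm_sq_eq]
  simp only [fderiv_coord_mul_comp_norm (q := fun t => η t / t ^ (n + 1)) hx hq,
    Finset.sum_add_distrib, ← Finset.sum_mul, hsq, Finset.sum_const, Finset.card_univ, hn,
    nsmul_eq_mul, add_tsub_cancel_right]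
  field_simp
  ring

lemma finrank_R3 : Module.finrank ℝ R3 = 3 := by simp

variable {u : R3 → ℝ} {g : R3 → R3}

lemma locallyIntegrable_coord (hg : LocallyIntegrable g) (i : Fin 3) :
    LocallyIntegrable fun x => g x i :=
  fun x => (hg x).imp fun _ hs => ⟨hs.1, (EuclideanSpace.proj i : R3 →L[ℝ] ℝ).integrable_comp hs.2⟩

lemma integral_sum_grad_mul_eq {Φ : Fin 3 → R3 → ℝ} (hg : IsWeakGradient u g)
    (hΦ : ∀ i, ContDiff ℝ ∞ (Φ i)) (hΦc : ∀ i, HasCompactSupport (Φ i)) :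
    ∫ x, u x * ∑ i, fderiv ℝ (Φ i) x (EuclideanSpace.single i 1) = -∫ x, ∑ i, g x i * Φ i x := by
  have hleft (i : Fin 3) : Integrable fun x =>
      u x * fderiv ℝ (Φ i) x (EuclideanSpace.single i 1) :=
    integrable_mul_of_hasCompactSupport hg.locallyIntegrable
      (((hΦ i).continuous_fderiv (by simp)).clm_apply continuous_const) ((hΦc i).fderiv_apply ℝ _)
  have hright (i : Fin 3) : Integrable fun x => g x i * Φ i x :=
    integrable_mul_of_hasCompactSupport (locallyIntegrable_coord hg.locallyIntegrable_grad i)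
      (hΦ i).continuous (hΦc i)
  simp only [Finset.mul_sum]
  rw [integral_finsetSum _ fun i _ => hleft i, integral_finsetSum _ fun i _ => hright i,
    ← Finset.sum_neg_distrib]
  exact Finset.sum_congr rfl fun i _ => hg.integral_eq (Φ i) (hΦ i) (hΦc i) i

/-- The radial component of a vector field. Its value at the origin is `0`. -/
noncomputable def radialPart (g : R3 → R3) (x : R3) : ℝ := inner ℝ x (g x) / ‖x‖

lemma norm_radialPart_le (x : R3) : ‖radialPart g x‖ ≤ ‖g x‖ := by
  rw [radialPart, norm_div, norm_norm]
  exact div_le_of_le_mul₀ (norm_nonneg x) (norm_nonneg _)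
    ((norm_inner_le_norm x (g x)).trans_eq (mul_comm _ _))

lemma aestronglyMeasurable_radialPart (hg : AEStronglyMeasurable g) :
    AEStronglyMeasurable (radialPart g) :=
  (aestronglyMeasurable_id.inner hg).div₀ aestronglyMeasurable_id.norm

lemma locallyIntegrable_radialPart (hg : LocallyIntegrable g) :
    LocallyIntegrable (radialPart g) :=
  hg.mono (aestronglyMeasurable_radialPart hg.aestronglyMeasurable)
    (ae_of_all _ norm_radialPart_le)

lemma sum_mul_coord_mul_comp_norm (x : R3) (η : ℝ → ℝ) :
    ∑ i, g x i * (x i * (η ‖x‖ / ‖x‖ ^ 3)) = radialPart g x * (η ‖x‖ / ‖x‖ ^ 2) := by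
  rcases eq_or_ne x 0 with rfl | hx
  · simp [radialPart]
  have hx0 : ‖x‖ ≠ 0 := norm_ne_zero_iff.2 hx
  have hinner : ∑ i, g x i * x i = inner ℝ x (g x) := by simp [PiLp.inner_apply]
  simp only [← mul_assoc, ← Finset.sum_mul, hinner, radialPart]
  field_simp

lemma integral_mul_comp_norm_div_sq {f : R3 → ℝ} (hf : LocallyIntegrable f) {ζ : ℝ → ℝ}
    (hζ : Continuous ζ) (hζc : HasCompactSupport ζ) (hζs : tsupport ζ ⊆ Ioi 0) :
    ∫ x, f x * (ζ ‖x‖ / ‖x‖ ^ 2) =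
      (volume : Measure R3).toSphere.real univ * ∫ t, sphericalMean volume f t * ζ t := by
  have hq : Continuous fun t => ζ t / t ^ 2 :=
    (contDiff_div_pow (contDiff_zero.2 hζ) (fun h => self_notMem_Ioi (hζs h)) 2).continuous
  have hqc := hasCompactSupport_comp_norm (E := R3) (hasCompactSupport_div_pow hζc 2)
  have hint := integrable_mul_of_hasCompactSupport hf (hq.comp' continuous_norm) hqc
  rw [integral_mul_comp_norm (q := fun t => ζ t / t ^ 2) hint, finrank_R3]
  congr 1
  trans ∫ t in Ioi 0, sphericalMean volume f t * ζ t
  · refine setIntegral_congr_fun measurableSet_Ioi fun t ht => ?_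
    have ht0 : t ≠ 0 := (mem_Ioi.1 ht).ne'
    simp only [Nat.add_one_sub_one]
    field_simp
  · refine setIntegral_eq_integral_of_forall_compl_eq_zero fun t ht => mul_eq_zero_of_right _ ?_
    exact image_eq_zero_of_notMem_tsupport fun h => ht (hζs h)

lemma IsWeakGradient.integral_sphericalMean_mul_deriv (hg : IsWeakGradient u g) {η : ℝ → ℝ}
    (hη : ContDiff ℝ ∞ η) (hηc : HasCompactSupport η) (hηs : tsupport η ⊆ Ioi 0) :
    ∫ t, sphericalMean volume u t * deriv η t =
      -∫ t, sphericalMean volume (radialPart g) t * η t := by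
  have hη0 : (0 : ℝ) ∉ tsupport η := fun h => self_notMem_Ioi (hηs h)
  have hq := contDiff_div_pow hη hη0 3
  have hΦ (i : Fin 3) : ContDiff ℝ ∞ fun x : R3 => x i * (η ‖x‖ / ‖x‖ ^ 3) :=
    (EuclideanSpace.proj i : R3 →L[ℝ] ℝ).contDiff.mul
      (contDiff_comp_norm hq fun h => hη0 (tsupport_div_pow_subset η 3 h))
  have hqc := hasCompactSupport_comp_norm (E := R3) (hasCompactSupport_div_pow hηc 3)
  have hΦc (i : Fin 3) : HasCompactSupport fun x : R3 => x i * (η ‖x‖ / ‖x‖ ^ 3) := hqc.mul_left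
  have hdiv : ∫ x, u x * (deriv η ‖x‖ / ‖x‖ ^ 2) = -∫ x, radialPart g x * (η ‖x‖ / ‖x‖ ^ 2) := by
    have h := integral_sum_grad_mul_eq hg hΦ hΦc
    simp only [sum_mul_coord_mul_comp_norm] at h
    rw [← h]
    refine integral_congr_ae ?_
    filter_upwards [compl_mem_ae_iff.2 (measure_singleton (0 : R3))] with x hx
    rw [sum_fderiv_coord_mul_comp_norm hx (hη.differentiable (by simp) _).hasDerivAt (n := 2) rfl]
  have hσ : (volume : Measure R3).toSphere.real univ ≠ 0 :=
    (measureReal_ne_zero_iff (measure_ne_top _ _)).2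
      (Measure.measure_univ_ne_zero.2 (Measure.toSphere_ne_zero _))
  refine mul_left_cancel₀ hσ ?_
  rw [mul_neg, ← integral_mul_comp_norm_div_sq hg.locallyIntegrable
      (hη.continuous_deriv (by simp)) hηc.deriv ((tsupport_deriv_subset (f := η)).trans hηs),
    ← integral_mul_comp_norm_div_sq (locallyIntegrable_radialPart hg.locallyIntegrable_grad)
      hη.continuous hηc hηs, hdiv]

lemma IsWeakGradient.exists_radial_primitive (hg : IsWeakGradient u g) (hu : IsRadial u) :
    ∃ w : ℝ → ℝ, (∀ᵐ x, u x = w ‖x‖) ∧ ∀ r s, 0 < r → 0 < s →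
      w s - w r = ∫ t in r..s, sphericalMean volume (radialPart g) t := by
  obtain ⟨f, hf⟩ := hu
  set h := sphericalMean volume (radialPart g)
  have hderiv : LocallyIntegrableOn h (Ioi 0) := locallyIntegrableOn_sphericalMean
    (locallyIntegrable_radialPart hg.locallyIntegrable_grad)
  obtain ⟨c, hc⟩ := exists_ae_eq_add_primitive isOpen_Ioi (mem_Ioi.2 one_pos)
    (locallyIntegrableOn_sphericalMean hg.locallyIntegrable) hderiv
    fun η hη hηc hηs => hg.integral_sphericalMean_mul_deriv hη hηc hηs
  have hint (s : ℝ) (hs : 0 < s) :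
      IntervalIntegrable h volume 1 s :=
    (hderiv.integrableOn_compact_subset (fun t ht => (lt_min one_pos hs).trans_le ht.1)
      isCompact_uIcc).intervalIntegrable
  refine ⟨fun s => c + ∫ t in (1)..s, h t, ?_, fun r s hr hs => ?_⟩
  · have hfc : ∀ᵐ t ∂volume.restrict (Ioi 0), f t = c + ∫ r in (1)..t, h r := by
      filter_upwards [(ae_restrict_iff' measurableSet_Ioi).2 hc, sphericalMean_ae_eq hf]
        with t htc htf
      rw [← htf, htc]
    filter_upwards [hf, ae_comp_norm volume hfc] with x hx hxc
    rw [hx, hxc]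
  · rw [add_sub_add_left_eq_sub,
      intervalIntegral.integral_interval_sub_left (hint s hs) (hint r hr)]

end RadialDerivative

section Profile

/-- `w` is the profile `t = |x| ↦ u(x)` of a radial function `u` on `ℝ³`, with derivative `h`. The
Dirichlet energy of `u` bounds `∫ t² h²`, and its Coulomb energy the mass of `u²` in balls. -/
structure IsProfile (w h : ℝ → ℝ) (N : ℝ≥0) : Prop where
  aemeasurable_deriv : AEMeasurable h (volume.restrict (Ioi 0))
  sub_eq : ∀ r s, 0 < r → 0 < s → w s - w r = ∫ t in r..s, h t
  lintegral_deriv_le : ∫⁻ t in Ioi (0 : ℝ), ENNReal.ofReal (t ^ 2) * ‖h t‖ₑ ^ 2 ≤ N ^ 2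
  lintegral_mass_le : ∀ R, 0 < R →
    ∫⁻ t in Ioc 0 R, ENNReal.ofReal (t ^ 2) * ‖w t‖ₑ ^ 2 ≤ N ^ 2 * ENNReal.ofReal √R

lemma lintegral_inv_sq_Ioc {r s : ℝ} (hr : 0 < r) (hrs : r ≤ s) :
    ∫⁻ t in Ioc r s, ENNReal.ofReal t⁻¹ ^ 2 = ENNReal.ofReal (r⁻¹ - s⁻¹) := by
  have h0 : (0 : ℝ) ∉ uIcc r s := by
    rw [uIcc_of_le hrs]
    exact fun h => hr.not_ge h.1
  have hint : IntervalIntegrable (fun t : ℝ => t ^ (-2 : ℤ)) volume r s :=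
    intervalIntegral.intervalIntegrable_zpow (.inr h0)
  have hcongr : ∀ t ∈ Ioc r s, ENNReal.ofReal t⁻¹ ^ 2 = ENNReal.ofReal (t ^ (-2 : ℤ)) :=
    fun t ht => by
      rw [← ENNReal.ofReal_pow (inv_nonneg.2 (hr.trans ht.1).le), inv_pow, zpow_neg, zpow_ofNat]
  rw [setLIntegral_congr_fun measurableSet_Ioc hcongr, ← ofReal_integral_eq_lintegral_ofReal hint.1
    (ae_of_all _ fun t => Even.zpow_nonneg (by decide) t), ← intervalIntegral.integral_of_le hrs,
    integral_zpow (.inr ⟨by decide, h0⟩)]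
  norm_num
  ring_nf

lemma rpow_sub_two_mul_sq (x : ℝ≥0∞) {p : ℝ} (hp : 2 ≤ p) : x ^ (p - 2) * x ^ 2 = x ^ p := by
  rw [← ENNReal.rpow_two, ← ENNReal.rpow_add_of_nonneg _ _ (by linarith) zero_le_two,
    sub_add_cancel]

lemma enorm_rpow_le_of_abs_le {x K c p t : ℝ} (hK : 0 ≤ K) (ht : 0 < t) (hp : 2 ≤ p)
    (hx : |x| ≤ K * t ^ c) :
    ‖x‖ₑ ^ p ≤ ENNReal.ofReal K ^ (p - 2) * (ENNReal.ofReal (t ^ (c * (p - 2))) * ‖x‖ₑ ^ 2) := by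
  have hx' : ‖x‖ₑ ≤ ENNReal.ofReal K * ENNReal.ofReal (t ^ c) := by
    rw [← ENNReal.ofReal_mul hK, ← ofReal_norm]
    exact ENNReal.ofReal_le_ofReal hx
  calc ‖x‖ₑ ^ p = ‖x‖ₑ ^ (p - 2) * ‖x‖ₑ ^ 2 := (rpow_sub_two_mul_sq _ hp).symm
    _ ≤ (ENNReal.ofReal K * ENNReal.ofReal (t ^ c)) ^ (p - 2) * ‖x‖ₑ ^ 2 := by
        gcongr
    _ = _ := by
        rw [ENNReal.mul_rpow_of_nonneg _ _ (by linarith), mul_assoc, Real.rpow_mul ht.le,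
          ENNReal.ofReal_rpow_of_nonneg (Real.rpow_nonneg ht.le c) (by linarith)]

namespace IsProfile

variable {w h : ℝ → ℝ} {N : ℝ≥0} {p r s t R : ℝ}

lemma enorm_sub_le (hw : IsProfile w h N) (hr : 0 < r) (hrs : r ≤ s) :
    ‖w s - w r‖ₑ ≤ ∫⁻ t in Ioc r s, ‖h t‖ₑ := by
  rw [hw.sub_eq r s hr (hr.trans_le hrs), intervalIntegral.integral_of_le hrs]
  exact enorm_integral_le_lintegral_enorm _

lemma sq_sub_le_of_le (hw : IsProfile w h N) (hr : 0 < r) (hrs : r ≤ s) :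
    (w s - w r) ^ 2 ≤ N ^ 2 * (r⁻¹ - s⁻¹) := by
  have hsub : Ioc r s ⊆ Ioi 0 := fun t ht => hr.trans ht.1
  have hm := hw.aemeasurable_deriv.mono_measure (Measure.restrict_mono hsub le_rfl)
  have hsplit : ∫⁻ t in Ioc r s, ‖h t‖ₑ =
      ∫⁻ t in Ioc r s, ENNReal.ofReal t⁻¹ * (ENNReal.ofReal t * ‖h t‖ₑ) := by
    refine setLIntegral_congr_fun measurableSet_Ioc fun t ht => ?_
    have ht0 : 0 < t := hsub ht
    rw [← mul_assoc, ← ENNReal.ofReal_mul (inv_nonneg.2 ht0.le), inv_mul_cancel₀ ht0.ne',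
      ENNReal.ofReal_one, one_mul]
  have hderiv : ∫⁻ t in Ioc r s, (ENNReal.ofReal t * ‖h t‖ₑ) ^ 2 ≤ N ^ 2 := by
    refine le_trans ?_ hw.lintegral_deriv_le
    refine (setLIntegral_congr_fun measurableSet_Ioc fun t ht => ?_).trans_le
      (lintegral_mono_set hsub)
    rw [mul_pow, ← ENNReal.ofReal_pow (hsub ht).le]
  have hE : ‖w s - w r‖ₑ ^ 2 ≤ ENNReal.ofReal (r⁻¹ - s⁻¹) * N ^ 2 := by
    refine (pow_le_pow_left' ((hw.enorm_sub_le hr hrs).trans_eq hsplit) 2).trans ?_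
    refine (sq_lintegral_mul_le _ (by fun_prop) (by fun_prop)).trans ?_
    rw [lintegral_inv_sq_Ioc hr hrs]
    gcongr
  have hinv : 0 ≤ r⁻¹ - s⁻¹ := sub_nonneg.2 (inv_anti₀ hr hrs)
  rwa [← ofReal_norm, ← ENNReal.ofReal_pow (norm_nonneg _), Real.norm_eq_abs, sq_abs,
    ← ENNReal.ofReal_coe_nnreal, ← ENNReal.ofReal_pow N.coe_nonneg, ← ENNReal.ofReal_mul hinv,
    ENNReal.ofReal_le_ofReal_iff (by positivity), mul_comm] at hE

lemma sq_sub_le (hw : IsProfile w h N) (hr : 0 < r) (hs : 0 < s) :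
    (w s - w r) ^ 2 ≤ N ^ 2 * |r⁻¹ - s⁻¹| := by
  rcases le_total r s with hrs | hsr
  · exact (hw.sq_sub_le_of_le hr hrs).trans (by gcongr; exact le_abs_self _)
  · rw [← neg_sub, neg_sq, abs_sub_comm]
    exact (hw.sq_sub_le_of_le hs hsr).trans (by gcongr; exact le_abs_self _)

lemma abs_sub_le (hw : IsProfile w h N) (hr : 0 < r) (hs : 0 < s) :
    |w s - w r| ≤ N * √|r⁻¹ - s⁻¹| := by
  rw [← Real.sqrt_sq N.coe_nonneg, ← Real.sqrt_mul (sq_nonneg _)]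
  exact Real.abs_le_sqrt (hw.sq_sub_le hr hs)

lemma continuousOn (hw : IsProfile w h N) : ContinuousOn w (Ioi 0) := by
  intro r (hr : 0 < r)
  rw [ContinuousWithinAt, tendsto_iff_norm_sub_tendsto_zero]
  have hlim : Tendsto (fun s : ℝ => N * √|r⁻¹ - s⁻¹|) (𝓝[Ioi 0] r) (𝓝 0) := by
    have hc : ContinuousAt (fun s : ℝ => N * √|r⁻¹ - s⁻¹|) r := by fun_prop (disch := exact hr.ne')
    simpa using hc.tendsto.mono_left nhdsWithin_le_nhds
  refine squeeze_zero' (.of_forall fun _ => norm_nonneg _) ?_ hlim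
  filter_upwards [self_mem_nhdsWithin] with s hs using hw.abs_sub_le hr hs

lemma aemeasurable (hw : IsProfile w h N) : AEMeasurable w (volume.restrict (Ioi 0)) :=
  hw.continuousOn.aemeasurable measurableSet_Ioi

lemma sq_mul_le (hw : IsProfile w h N) {l : ℝ} (hr : 0 < r) (hl : 0 < l) (hlr : l ≤ r) :
    l * (r ^ 2 * w r ^ 2) ≤ N ^ 2 * (2 * l ^ 2 + 2 * √(2 * r)) := by
  set c : ℝ := r ^ 2 * w r ^ 2 / 2 - N ^ 2 * l with hc
  have hlow : ∀ t ∈ Ioc r (r + l), ENNReal.ofReal c ≤ ENNReal.ofReal (t ^ 2) * ‖w t‖ₑ ^ 2 := by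
    intro t ht
    have ht0 : 0 < t := hr.trans ht.1
    have hinv : r ^ 2 * (r⁻¹ - t⁻¹) ≤ l := by
      have : r ^ 2 * (r⁻¹ - t⁻¹) = r / t * (t - r) := by field_simp
      rw [this]
      exact (mul_le_of_le_one_left (by linarith [ht.1]) ((div_le_one ht0).2 ht.1.le)).trans
        (by linarith [ht.2])
    have hsub := hw.sq_sub_le_of_le hr ht.1.le
    have hrt : r ^ 2 * w t ^ 2 ≤ t ^ 2 * w t ^ 2 := by
      gcongr
      exact ht.1.le
    rw [← ofReal_norm, ← ENNReal.ofReal_pow (norm_nonneg _), Real.norm_eq_abs, sq_abs,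
      ← ENNReal.ofReal_mul (sq_nonneg t)]
    refine ENNReal.ofReal_le_ofReal ?_
    have h1 : r ^ 2 * (w t - w r) ^ 2 ≤ N ^ 2 * l :=
      (mul_le_mul_of_nonneg_left hsub (sq_nonneg r)).trans <| by
        rw [mul_left_comm]
        gcongr
    nlinarith [mul_nonneg (sq_nonneg r) (sq_nonneg (2 * w t - w r))]
  have hmass : ENNReal.ofReal c * ENNReal.ofReal l ≤ N ^ 2 * ENNReal.ofReal √(2 * r) :=
    calc ENNReal.ofReal c * ENNReal.ofReal l = ∫⁻ _ in Ioc r (r + l), ENNReal.ofReal c := by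
          rw [setLIntegral_const, Real.volume_Ioc, add_sub_cancel_left]
      _ ≤ ∫⁻ t in Ioc r (r + l), ENNReal.ofReal (t ^ 2) * ‖w t‖ₑ ^ 2 :=
          setLIntegral_mono' measurableSet_Ioc hlow
      _ ≤ ∫⁻ t in Ioc 0 (2 * r), ENNReal.ofReal (t ^ 2) * ‖w t‖ₑ ^ 2 :=
          lintegral_mono_set (Ioc_subset_Ioc hr.le (by linarith))
      _ ≤ N ^ 2 * ENNReal.ofReal √(2 * r) := hw.lintegral_mass_le _ (by positivity)
  rw [← ENNReal.ofReal_mul' hl.le, ← ENNReal.ofReal_coe_nnreal, ← ENNReal.ofReal_pow N.coe_nonneg,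
    ← ENNReal.ofReal_mul (by positivity), ENNReal.ofReal_le_ofReal_iff (by positivity)] at hmass
  rw [hc] at hmass
  linarith

lemma abs_le_of_one_le (hw : IsProfile w h N) (hr : 1 ≤ r) :
    |w r| ≤ 3 * N * r ^ (-7 / 8 : ℝ) := by
  have hr0 : 0 < r := one_pos.trans_le hr
  -- the length `r ^ (1 / 4)` balances the two terms of `sq_mul_le`
  have h := hw.sq_mul_le hr0 (Real.rpow_pos_of_pos hr0 (1 / 4))
    ((Real.rpow_le_rpow_of_exponent_le hr (by norm_num)).trans_eq (Real.rpow_one r))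
  have hsqrt : √(2 * r) ≤ 3 / 2 * r ^ (1 / 2 : ℝ) := by
    rw [Real.sqrt_mul zero_le_two, ← Real.sqrt_eq_rpow]
    gcongr
    exact Real.sqrt_le_iff.2 (by norm_num)
  have hsq : (r ^ (1 / 4 : ℝ)) ^ 2 = r ^ (1 / 2 : ℝ) := by
    rw [← Real.rpow_mul_natCast hr0.le]
    norm_num
  have hpow : r ^ (1 / 4 : ℝ) * r ^ 2 * (r ^ (-7 / 8 : ℝ)) ^ 2 = r ^ (1 / 2 : ℝ) := by
    rw [← Real.rpow_mul_natCast hr0.le, ← Real.rpow_natCast, ← Real.rpow_add hr0,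
      ← Real.rpow_add hr0]
    norm_num
  have hwr : r ^ (1 / 4 : ℝ) * r ^ 2 * w r ^ 2 ≤
      r ^ (1 / 4 : ℝ) * r ^ 2 * (3 * N * r ^ (-7 / 8 : ℝ)) ^ 2 :=
    calc _ = r ^ (1 / 4 : ℝ) * (r ^ 2 * w r ^ 2) := mul_assoc ..
      _ ≤ N ^ 2 * (2 * r ^ (1 / 2 : ℝ) + 2 * (3 / 2 * r ^ (1 / 2 : ℝ))) := by
          rw [hsq] at h
          exact h.trans (by gcongr)
      _ ≤ 9 * N ^ 2 * r ^ (1 / 2 : ℝ) := by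
          nlinarith [mul_nonneg (sq_nonneg (N : ℝ)) (Real.rpow_nonneg hr0.le (1 / 2))]
      _ = _ := by
          rw [← hpow]
          ring
  exact abs_le_of_sq_le_sq (le_of_mul_le_mul_left hwr (by positivity)) (by positivity)

lemma tendsto_atTop (hw : IsProfile w h N) : Tendsto w atTop (𝓝 0) := by
  have hlim : Tendsto (fun r : ℝ => 3 * N * r ^ (-7 / 8 : ℝ)) atTop (𝓝 0) := by
    simpa [neg_div] using
      (tendsto_rpow_neg_atTop (show (0 : ℝ) < 7 / 8 by norm_num)).const_mul (3 * N : ℝ)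
  refine squeeze_zero_norm' ?_ hlim
  filter_upwards [eventually_ge_atTop 1] with r hr using hw.abs_le_of_one_le hr

lemma abs_le (hw : IsProfile w h N) (hr : 0 < r) : |w r| ≤ N * r ^ (-1 / 2 : ℝ) := by
  have hl := (hw.tendsto_atTop.sub_const (w r)).abs
  have hu := ((tendsto_inv_atTop_zero.const_sub r⁻¹).abs.sqrt).const_mul (N : ℝ)
  have hle := le_of_tendsto_of_tendsto hl hu <|
    (eventually_gt_atTop 0).mono fun s hs => hw.abs_sub_le hr hs
  rw [zero_sub, abs_neg, sub_zero, abs_of_pos (inv_pos.2 hr), Real.sqrt_eq_rpow,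
    Real.inv_rpow hr.le, ← Real.rpow_neg hr.le] at hle
  rwa [neg_div]

lemma enorm_le_lintegral_deriv (hw : IsProfile w h N) (hr : 0 < r) :
    ‖w r‖ₑ ≤ ∫⁻ t in Ioi r, ‖h t‖ₑ := by
  have hl := (hw.tendsto_atTop.sub_const (w r)).enorm
  rw [zero_sub, enorm_neg] at hl
  refine le_of_tendsto hl ?_
  filter_upwards [eventually_ge_atTop r] with s hs
  exact (hw.enorm_sub_le hr hs).trans (lintegral_mono_set Ioc_subset_Ioi_self)

lemma lintegral_sq_le (hw : IsProfile w h N) : ∫⁻ t in Ioi (0 : ℝ), ‖w t‖ₑ ^ 2 ≤ 4 * N ^ 2 :=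
  calc ∫⁻ t in Ioi (0 : ℝ), ‖w t‖ₑ ^ 2
      ≤ ∫⁻ r in Ioi (0 : ℝ), (∫⁻ t in Ioi r, ‖h t‖ₑ) ^ 2 :=
        setLIntegral_mono' measurableSet_Ioi fun _ hr =>
          pow_le_pow_left' (hw.enorm_le_lintegral_deriv hr) 2
    _ ≤ 4 * ∫⁻ t in Ioi (0 : ℝ), ENNReal.ofReal (t ^ 2) * ‖h t‖ₑ ^ 2 :=
        lintegral_sq_lintegral_Ioi_le hw.aemeasurable_deriv.enorm
    _ ≤ 4 * N ^ 2 := by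
        gcongr
        exact hw.lintegral_deriv_le

lemma lintegral_rpow_Ioc_le (hw : IsProfile w h N) (hp : 2 ≤ p) (hp6 : p ≤ 6) :
    ∫⁻ t in Ioc 0 1, ENNReal.ofReal (t ^ 2) * ‖w t‖ₑ ^ p ≤ 4 * N ^ p := by
  have hpt : ∀ t ∈ Ioc (0 : ℝ) 1, ENNReal.ofReal (t ^ 2) * ‖w t‖ₑ ^ p ≤
      (N : ℝ≥0∞) ^ (p - 2) * ‖w t‖ₑ ^ 2 := by
    intro t ht
    have hle := enorm_rpow_le_of_abs_le N.coe_nonneg ht.1 hp (hw.abs_le ht.1)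
    have hone : t ^ 2 * t ^ (-1 / 2 * (p - 2)) ≤ 1 := by
      rw [← Real.rpow_natCast, ← Real.rpow_add ht.1]
      exact Real.rpow_le_one ht.1.le ht.2 (by push_cast; linarith)
    calc _ ≤ _ := mul_le_mul_right hle _
      _ = (N : ℝ≥0∞) ^ (p - 2) *
          (ENNReal.ofReal (t ^ 2 * t ^ (-1 / 2 * (p - 2))) * ‖w t‖ₑ ^ 2) := by
          rw [ENNReal.ofReal_mul (sq_nonneg t), ENNReal.ofReal_coe_nnreal]
          ring
      _ ≤ _ := by
          gcongr
          exact mul_le_of_le_one_left' (ENNReal.ofReal_le_one.2 hone)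
  calc ∫⁻ t in Ioc 0 1, ENNReal.ofReal (t ^ 2) * ‖w t‖ₑ ^ p
      ≤ ∫⁻ t in Ioi 0, (N : ℝ≥0∞) ^ (p - 2) * ‖w t‖ₑ ^ 2 :=
        (setLIntegral_mono' measurableSet_Ioc hpt).trans (lintegral_mono_set Ioc_subset_Ioi_self)
    _ = (N : ℝ≥0∞) ^ (p - 2) * ∫⁻ t in Ioi (0 : ℝ), ‖w t‖ₑ ^ 2 :=
        lintegral_const_mul'' _ (hw.aemeasurable.enorm.pow_const 2)
    _ ≤ (N : ℝ≥0∞) ^ (p - 2) * (4 * N ^ 2) := by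
        gcongr
        exact hw.lintegral_sq_le
    _ = 4 * N ^ p := by
        rw [mul_left_comm, rpow_sub_two_mul_sq _ hp]

lemma lintegral_rpow_Ioi_le (hw : IsProfile w h N) (hp : 18 / 7 < p) (hR : 1 ≤ R) :
    ∫⁻ t in Ioi R, ENNReal.ofReal (t ^ 2) * ‖w t‖ₑ ^ p ≤
      3 ^ (p - 2) * ENNReal.ofReal (7 * (p - 2) / (7 * p - 18) * R ^ ((18 - 7 * p) / 8)) *
        N ^ p := by
  have hR0 : 0 < R := one_pos.trans_le hR
  set a : ℝ := 7 / 8 * (p - 2) with ha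
  have hpt : ∀ t ∈ Ioi R, ENNReal.ofReal (t ^ 2) * ‖w t‖ₑ ^ p ≤ ENNReal.ofReal (3 * N) ^ (p - 2) *
      (ENNReal.ofReal (t ^ (-a)) * (ENNReal.ofReal (t ^ 2) * ‖w t‖ₑ ^ 2)) := by
    intro t ht
    have hle := enorm_rpow_le_of_abs_le (p := p) (by positivity) (hR0.trans ht) (by linarith)
      (hw.abs_le_of_one_le (hR.trans (le_of_lt ht)))
    refine (mul_le_mul_right hle _).trans_eq ?_
    rw [show -7 / 8 * (p - 2) = -a by rw [ha]; ring]
    ring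
  have hmass : ∀ s, R < s → ∫⁻ t in Ioo R s, ENNReal.ofReal (t ^ 2) * ‖w t‖ₑ ^ 2 ≤
      N ^ 2 * ENNReal.ofReal (s ^ (1 / 2 : ℝ)) := by
    intro s hs
    rw [← Real.sqrt_eq_rpow]
    exact (lintegral_mono_set (Ioo_subset_Ioc_self.trans (Ioc_subset_Ioc_left hR0.le))).trans
      (hw.lintegral_mass_le s (hR0.trans hs))
  have hm : AEMeasurable w (volume.restrict (Ioi R)) :=
    hw.aemeasurable.mono_measure (Measure.restrict_mono (Ioi_subset_Ioi hR0.le) le_rfl)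
  calc _ ≤ ENNReal.ofReal (3 * N) ^ (p - 2) * ∫⁻ t in Ioi R,
        ENNReal.ofReal (t ^ (-a)) * (ENNReal.ofReal (t ^ 2) * ‖w t‖ₑ ^ 2) :=
        (setLIntegral_mono' measurableSet_Ioi hpt).trans_eq (lintegral_const_mul'' _ (by fun_prop))
    _ ≤ ENNReal.ofReal (3 * N) ^ (p - 2) *
        (N ^ 2 * ENNReal.ofReal (a / (a - 1 / 2) * R ^ (1 / 2 - a))) := by
        gcongr
        exact lintegral_Ioi_rpow_mul_le hR0 (by linarith) (by linarith) (by fun_prop) hmass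
    _ = _ := by
        have h18 : 7 * p - 18 ≠ 0 := by linarith
        have hcoef : a / (a - 1 / 2) = 7 * (p - 2) / (7 * p - 18) := by
          rw [ha, div_eq_div_iff (by linarith) h18]
          ring
        rw [hcoef, show 1 / 2 - a = (18 - 7 * p) / 8 by rw [ha]; ring,
          ENNReal.ofReal_mul zero_le_three, ENNReal.mul_rpow_of_nonneg _ _ (by linarith),
          ENNReal.ofReal_coe_nnreal, ENNReal.ofReal_ofNat,
          ← rpow_sub_two_mul_sq _ (by linarith : 2 ≤ p)]
        ring

end IsProfile

end Profile

section Inclusion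

lemma two_le_toSphere_univ : 2 ≤ (volume : Measure R3).toSphere univ := by
  rw [Measure.toSphere_apply_univ, EuclideanSpace.volume_ball_fin_three, finrank_R3]
  calc (2 : ℝ≥0∞) ≤ 3 * ENNReal.ofReal 1 := by norm_num
    _ ≤ 3 * ENNReal.ofReal (Real.pi * 4 / 3) := by
        gcongr
        linarith [Real.pi_gt_three]
    _ = _ := by simp

lemma sq_lintegral_closedBall_le_energy {u : R3 → ℝ} (hu : AEMeasurable u) {R : ℝ} (hR : 0 ≤ R) :
    (∫⁻ x in closedBall 0 R, ‖u x‖ₑ ^ 2) ^ 2 ≤ ENNReal.ofReal (2 * R) * energy u := by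
  have hpt : ∀ x ∈ closedBall (0 : R3) R, ∀ᵐ y ∂volume.restrict (closedBall (0 : R3) R),
      ‖u x‖ₑ ^ 2 * ‖u y‖ₑ ^ 2 ≤
        ENNReal.ofReal (2 * R) * ENNReal.ofReal (u x ^ 2 * u y ^ 2 / ‖x - y‖) := by
    intro x hx
    filter_upwards [ae_restrict_mem measurableSet_closedBall,
      ae_restrict_of_ae (compl_mem_ae_iff.2 (measure_singleton x))] with y hy hyx
    have hpos : 0 < ‖x - y‖ := norm_sub_pos_iff.2 (Ne.symm hyx)
    have hle : ‖x - y‖ ≤ 2 * R := by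
      linarith [norm_sub_le x y, mem_closedBall_zero_iff.1 hx, mem_closedBall_zero_iff.1 hy]
    rw [← mul_pow, ← enorm_mul, ← ofReal_norm, ← ENNReal.ofReal_pow (norm_nonneg _),
      ← ENNReal.ofReal_mul (by positivity), Real.norm_eq_abs, sq_abs, mul_pow]
    refine ENNReal.ofReal_le_ofReal ?_
    rw [mul_div_left_comm]
    exact le_mul_of_one_le_right (by positivity) ((one_le_div hpos).2 hle)
  calc (∫⁻ x in closedBall 0 R, ‖u x‖ₑ ^ 2) ^ 2
      = ∫⁻ x in closedBall 0 R, ∫⁻ y in closedBall 0 R, ‖u x‖ₑ ^ 2 * ‖u y‖ₑ ^ 2 := by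
        rw [sq, ← lintegral_mul_const'' _ (by fun_prop)]
        simp_rw [lintegral_const_mul' _ _ (ENNReal.pow_ne_top enorm_ne_top)]
    _ ≤ ∫⁻ x in closedBall 0 R, ∫⁻ y in closedBall 0 R,
        ENNReal.ofReal (2 * R) * ENNReal.ofReal (u x ^ 2 * u y ^ 2 / ‖x - y‖) :=
        setLIntegral_mono' measurableSet_closedBall fun x hx => lintegral_mono_ae (hpt x hx)
    _ ≤ ∫⁻ x, ∫⁻ y, ENNReal.ofReal (2 * R) * ENNReal.ofReal (u x ^ 2 * u y ^ 2 / ‖x - y‖) :=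
        (setLIntegral_le_lintegral _ _).trans
          (lintegral_mono fun x => setLIntegral_le_lintegral _ _)
    _ = ENNReal.ofReal (2 * R) * energy u := by
        simp_rw [lintegral_const_mul' _ _ ENNReal.ofReal_ne_top, energy]

lemma isWeakGradient_weakGrad {u : R3 → ℝ} (h : ∃ g, IsWeakGradient u g) :
    IsWeakGradient u (weakGrad u) := by
  rw [weakGrad, dif_pos h]
  exact h.choose_spec

lemma IsWeakGradient.ae_eq {u : R3 → ℝ} {g g' : R3 → R3} (hg : IsWeakGradient u g)
    (hg' : IsWeakGradient u g') : g =ᵐ[volume] g' := by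
  have hcoord (i : Fin 3) : ∀ᵐ x, g x i = g' x i :=
    ae_eq_of_integral_contDiff_smul_eq (locallyIntegrable_coord hg.locallyIntegrable_grad i)
      (locallyIntegrable_coord hg'.locallyIntegrable_grad i) fun φ hφ hφc => by
        simp only [smul_eq_mul, mul_comm (φ _)]
        linarith [hg.integral_eq φ hφ hφc i, hg'.integral_eq φ hφ hφc i]
  filter_upwards [ae_all_iff.2 hcoord] with x hx
  ext i
  exact hx i

lemma normE_lt_top {u : R3 → ℝ} (hu : MemEr u) : normE u < ⊤ := by
  obtain ⟨g, hg, hg2⟩ := hu.memD12.exists_grad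
  have hgrad : ∫⁻ x, ‖weakGrad u x‖ₑ ^ 2 < ⊤ := by
    have hg2 := lintegral_rpow_enorm_lt_top_of_eLpNorm_lt_top (by simp) (by simp) hg2.2
    simp only [ENNReal.toReal_ofNat, ENNReal.rpow_two] at hg2
    refine lt_of_eq_of_lt (lintegral_congr_ae ?_) hg2
    filter_upwards [(isWeakGradient_weakGrad ⟨g, hg⟩).ae_eq hg] with x hx
    rw [hx]
  have henergy := ENNReal.rpow_lt_top_of_nonneg (y := 1 / 2) (by simp) hu.energy_lt_top.ne
  exact ENNReal.rpow_lt_top_of_nonneg (by simp) (ENNReal.add_lt_top.2 ⟨hgrad, henergy⟩).ne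

lemma lintegral_sq_le_of_energy_le {u : R3 → ℝ} {w : ℝ → ℝ} {N : ℝ≥0} (hu : LocallyIntegrable u)
    (huw : ∀ᵐ x, u x = w ‖x‖) (hN : energy u ^ (1 / 2 : ℝ) ≤ N ^ 2) {R : ℝ} (hR : 0 ≤ R) :
    ∫⁻ t in Ioc 0 R, ENNReal.ofReal (t ^ 2) * ‖w t‖ₑ ^ 2 ≤ N ^ 2 * ENNReal.ofReal √R := by
  have hw := aemeasurable_of_ae_eq_comp_norm hu huw
  have hball : closedBall (0 : R3) R = norm ⁻¹' Iic R := by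
    ext
    simp
  have hpolar : ∫⁻ x in closedBall 0 R, ‖u x‖ₑ ^ 2 = (volume : Measure R3).toSphere univ *
      ∫⁻ t in Ioc 0 R, ENNReal.ofReal (t ^ 2) * ‖w t‖ₑ ^ 2 := by
    rw [lintegral_congr_ae (g := fun x => ‖w ‖x‖‖ₑ ^ 2), hball,
      setLIntegral_comp_norm volume (f := fun t => ‖w t‖ₑ ^ 2) (by fun_prop) measurableSet_Iic,
      finrank_R3, inter_comm, Ioi_inter_Iic]
    filter_upwards [ae_restrict_of_ae huw] with x hx
    rw [hx]
  have hR2 : ENNReal.ofReal √R ^ 2 = ENNReal.ofReal R := by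
    rw [← ENNReal.ofReal_pow (Real.sqrt_nonneg R), Real.sq_sqrt hR]
  have hE : energy u ≤ (N ^ 2) ^ 2 := by
    rwa [one_div, ENNReal.rpow_inv_le_iff two_pos, ENNReal.rpow_two] at hN
  have hsq := sq_lintegral_closedBall_le_energy hu.aestronglyMeasurable.aemeasurable hR
  rw [hpolar] at hsq
  refine (ENNReal.mul_le_mul_iff_right two_ne_zero ENNReal.ofNat_ne_top).1 <|
    (mul_le_mul_left two_le_toSphere_univ _).trans <|
      (ENNReal.pow_le_pow_left_iff two_ne_zero).1 <| hsq.trans ?_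
  calc ENNReal.ofReal (2 * R) * energy u ≤ ENNReal.ofReal (4 * R) * (N ^ 2) ^ 2 := by
        gcongr
        norm_num
    _ = (2 * (N ^ 2 * ENNReal.ofReal √R)) ^ 2 := by
        rw [mul_pow, mul_pow, hR2, ENNReal.ofReal_mul (by norm_num), ENNReal.ofReal_ofNat]
        ring

lemma MemEr.exists_profile {u : R3 → ℝ} (hu : MemEr u) {N : ℝ≥0} (hN : normE u ≤ N) :
    ∃ w h, (∀ᵐ x, u x = w ‖x‖) ∧ IsProfile w h N := by
  obtain ⟨g, hg, -⟩ := hu.memD12.exists_grad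
  have hw := isWeakGradient_weakGrad ⟨g, hg⟩
  obtain ⟨w, huw, hsub⟩ := hw.exists_radial_primitive hu.radial
  have hsum : (∫⁻ x, ‖weakGrad u x‖ₑ ^ 2) + energy u ^ (1 / 2 : ℝ) ≤ N ^ 2 := by
    rwa [normE, one_div, ENNReal.rpow_inv_le_iff two_pos, ENNReal.rpow_two, ← one_div] at hN
  have hgm := hw.locallyIntegrable_grad
  have hr := locallyIntegrable_radialPart hgm
  refine ⟨w, _, huw, ?_, hsub, ?_, fun R hR =>
    lintegral_sq_le_of_energy_le hw.locallyIntegrable huw (le_add_self.trans hsum) hR.le⟩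
  · exact (locallyIntegrableOn_sphericalMean hr).aestronglyMeasurable.aemeasurable
  · have hle := lintegral_enorm_sphericalMean_sq_le hr.aestronglyMeasurable
    rw [finrank_R3] at hle
    calc _ ≤ _ := le_mul_of_one_le_left' (one_le_two.trans two_le_toSphere_univ)
      _ ≤ ∫⁻ x, ‖radialPart (weakGrad u) x‖ₑ ^ 2 := hle
      _ ≤ ∫⁻ x, ‖weakGrad u x‖ₑ ^ 2 := by
          gcongr with x
          exact enorm_le_iff_norm_le.2 (norm_radialPart_le x)
      _ ≤ N ^ 2 := le_self_add.trans hsum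

namespace IsProfile

variable {w h : ℝ → ℝ} {N : ℝ≥0} {p R : ℝ} {u : R3 → ℝ}

lemma setLIntegral_rpow_eq (hw : IsProfile w h N) (hu : ∀ᵐ x, u x = w ‖x‖) {s : Set ℝ}
    (hs : MeasurableSet s) (p : ℝ) :
    ∫⁻ x in norm ⁻¹' s, ‖u x‖ₑ ^ p = (volume : Measure R3).toSphere univ *
      ∫⁻ t in s ∩ Ioi 0, ENNReal.ofReal (t ^ 2) * ‖w t‖ₑ ^ p := by
  have hm := hw.aemeasurable
  rw [lintegral_congr_ae (g := fun x => ‖w ‖x‖‖ₑ ^ p),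
    setLIntegral_comp_norm volume (f := fun t => ‖w t‖ₑ ^ p) (by fun_prop) hs, finrank_R3]
  filter_upwards [ae_restrict_of_ae hu] with x hx
  rw [hx]

lemma lintegral_rpow_le (hw : IsProfile w h N) (hu : ∀ᵐ x, u x = w ‖x‖) (hp : 18 / 7 < p)
    (hp6 : p ≤ 6) :
    ∫⁻ x, ‖u x‖ₑ ^ p ≤ (volume : Measure R3).toSphere univ *
      (4 + 3 ^ (p - 2) * ENNReal.ofReal (7 * (p - 2) / (7 * p - 18))) * N ^ p := by
  have hpolar := hw.setLIntegral_rpow_eq hu .univ p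
  have htail := hw.lintegral_rpow_Ioi_le hp le_rfl
  rw [Real.one_rpow, mul_one] at htail
  rw [preimage_univ, Measure.restrict_univ, univ_inter, ← Ioc_union_Ioi_eq_Ioi zero_le_one,
    lintegral_union measurableSet_Ioi (Ioc_disjoint_Ioi le_rfl)] at hpolar
  rw [hpolar, mul_assoc, add_mul]
  gcongr
  exact hw.lintegral_rpow_Ioc_le (by linarith) hp6

end IsProfile

lemma toReal_mem_Ioc {p : ℝ≥0∞} (hp : 18 / 7 < p) (hp6 : p ≤ 6) :
    p.toReal ∈ Ioc (18 / 7 : ℝ) 6 := by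
  have hpt : p ≠ ⊤ := (hp6.trans_lt (by simp)).ne
  constructor
  · simpa using (ENNReal.toReal_lt_toReal (hp.trans_le le_top).ne hpt).2 hp
  · simpa using (ENNReal.toReal_le_toReal hpt (by simp)).2 hp6

lemma eLpNorm_le_of_lintegral_le {α : Type*} [MeasurableSpace α] {μ : Measure α} {u : α → ℝ}
    {p C N : ℝ≥0∞} (hp0 : p ≠ 0) (hpt : p ≠ ⊤) (h : ∫⁻ x, ‖u x‖ₑ ^ p.toReal ∂μ ≤ C * N ^ p.toReal) :
    eLpNorm u p μ ≤ C ^ p.toReal⁻¹ * N := by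
  have hp : 0 < p.toReal := ENNReal.toReal_pos hp0 hpt
  rwa [eLpNorm_eq_lintegral_rpow_enorm_toReal hp0 hpt, one_div, ENNReal.rpow_inv_le_iff hp,
    ENNReal.mul_rpow_of_nonneg _ _ hp.le, ENNReal.rpow_inv_rpow hp.ne']

theorem continuous_inclusion (p : ℝ≥0∞) (hp : 18 / 7 < p) (hp6 : p ≤ 6) :
    ∃ C : ℝ≥0, ∀ u : R3 → ℝ, MemEr u →
      MemLp u p volume ∧ eLpNorm u p volume ≤ C * normE u := by
  obtain ⟨hpr, hpr6⟩ := toReal_mem_Ioc hp hp6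
  have hp0 : p ≠ 0 := (zero_le.trans_lt hp).ne'
  have hpt : p ≠ ⊤ := (hp6.trans_lt (by simp)).ne
  set q := p.toReal
  set C := (volume : Measure R3).toSphere univ *
      (4 + 3 ^ (q - 2) * ENNReal.ofReal (7 * (q - 2) / (7 * q - 18)))
  have hC : C ^ q⁻¹ ≠ ⊤ := by finiteness
  refine ⟨(C ^ q⁻¹).toNNReal, fun u hu => ?_⟩
  have hN := ENNReal.coe_toNNReal (normE_lt_top hu).ne
  obtain ⟨w, h, huw, hw⟩ := hu.exists_profile hN.ge
  have hle := eLpNorm_le_of_lintegral_le hp0 hpt (hw.lintegral_rpow_le huw hpr hpr6)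
  rw [ENNReal.coe_toNNReal hC, ← hN]
  exact ⟨⟨hu.memD12.memLp_six.1, hle.trans_lt (by finiteness)⟩, hle⟩

end Inclusion

section Compactness

lemma exists_subseq_tendsto_of_equicontinuous {X : Type*} [TopologicalSpace X]
    [TopologicalSpace.SeparableSpace X] {f : ℕ → X → ℝ} (hf : Equicontinuous f) {b : X → ℝ}
    (hb : ∀ n x, |f n x| ≤ b x) :
    ∃ k : ℕ → ℕ, StrictMono k ∧ ∃ v : X → ℝ, ∀ x, Tendsto (fun n => f (k n) x) atTop (𝓝 (v x)) := by
  obtain ⟨D, hDc, hD⟩ := TopologicalSpace.exists_countable_dense X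
  have : Countable D := hDc
  obtain ⟨a, -, k, hk, hlim⟩ :=
    (isCompact_univ_pi fun d : D => isCompact_Icc (a := -b d) (b := b d)).tendsto_subseq
      (x := fun n (d : D) => f n d) fun n d _ => abs_le.1 (hb n d)
  rw [tendsto_pi_nhds] at hlim
  suffices hcau : ∀ x, CauchySeq fun n => f (k n) x by
    choose v hv using fun x => cauchySeq_tendsto_of_complete (hcau x)
    exact ⟨k, hk, v, hv⟩
  intro x
  rw [Metric.cauchySeq_iff]
  intro ε hε
  obtain ⟨d, hd, hdD⟩ := mem_closure_iff_nhds.1 (hD x) _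
    (Metric.equicontinuousAt_iff_right.1 (hf x) (ε / 3) (by positivity))
  obtain ⟨N, hN⟩ := Metric.cauchySeq_iff.1 (hlim ⟨d, hdD⟩).cauchySeq (ε / 3) (by positivity)
  refine ⟨N, fun m hm n hn => ?_⟩
  calc dist (f (k m) x) (f (k n) x)
      ≤ dist (f (k m) x) (f (k m) d) + dist (f (k m) d) (f (k n) d) +
          dist (f (k n) d) (f (k n) x) := dist_triangle4 _ _ _ _
    _ < ε / 3 + ε / 3 + ε / 3 := by
        gcongr
        · exact hd (k m)
        · exact hN m hm n hn
        · rw [dist_comm]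
          exact hd (k n)
    _ = ε := by ring

section Measure

variable {α : Type*} [MeasurableSpace α] {μ : Measure α} {f : ℕ → α → ℝ} {v : α → ℝ} {p : ℝ}

lemma lintegral_rpow_le_of_tendsto (hf : ∀ n, AEMeasurable (f n) μ)
    (hlim : ∀ᵐ x ∂μ, Tendsto (fun n => f n x) atTop (𝓝 (v x))) {B : ℝ≥0∞}
    (hB : ∀ n, ∫⁻ x, ‖f n x‖ₑ ^ p ∂μ ≤ B) : ∫⁻ x, ‖v x‖ₑ ^ p ∂μ ≤ B := by
  calc ∫⁻ x, ‖v x‖ₑ ^ p ∂μ = ∫⁻ x, liminf (fun n => ‖f n x‖ₑ ^ p) atTop ∂μ := by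
        refine lintegral_congr_ae ?_
        filter_upwards [hlim] with x hx
        exact ((ENNReal.continuous_rpow_const.tendsto _).comp hx.enorm).liminf_eq.symm
    _ ≤ liminf (fun n => ∫⁻ x, ‖f n x‖ₑ ^ p ∂μ) atTop :=
        lintegral_liminf_le' fun n => (hf n).enorm.pow_const p
    _ ≤ B := by
        refine liminf_le_of_le (by isBoundedDefault) fun b hb => ?_
        obtain ⟨n, hn⟩ := hb.exists
        exact hn.trans (hB n)

lemma lintegral_rpow_sub_le (hv : AEMeasurable v μ) {f : α → ℝ} (hp : 1 ≤ p) {B : ℝ≥0∞}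
    (hfB : ∫⁻ x, ‖f x‖ₑ ^ p ∂μ ≤ B) (hvB : ∫⁻ x, ‖v x‖ₑ ^ p ∂μ ≤ B) :
    ∫⁻ x, ‖f x - v x‖ₑ ^ p ∂μ ≤ 2 ^ p * B := by
  have hpow : (2 : ℝ≥0∞) ^ (p - 1) ≠ ⊤ := by finiteness
  calc ∫⁻ x, ‖f x - v x‖ₑ ^ p ∂μ
      ≤ ∫⁻ x, 2 ^ (p - 1) * (‖f x‖ₑ ^ p + ‖v x‖ₑ ^ p) ∂μ := by
        refine lintegral_mono fun x => ?_
        refine le_trans ?_ (ENNReal.rpow_add_le_mul_rpow_add_rpow _ _ hp)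
        gcongr
        exact enorm_sub_le
    _ = 2 ^ (p - 1) * ((∫⁻ x, ‖f x‖ₑ ^ p ∂μ) + ∫⁻ x, ‖v x‖ₑ ^ p ∂μ) := by
        rw [lintegral_const_mul' _ _ hpow, lintegral_add_right' _ (hv.enorm.pow_const p)]
    _ ≤ 2 ^ (p - 1) * (B + B) := by gcongr
    _ = 2 ^ p * B := by
        rw [← two_mul, ← mul_assoc, mul_comm _ (2 : ℝ≥0∞),
          ENNReal.rpow_sub _ _ two_ne_zero ENNReal.ofNat_ne_top, ENNReal.rpow_one,
          ENNReal.mul_div_cancel two_ne_zero ENNReal.ofNat_ne_top]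

lemma tendsto_lintegral_rpow_sub_of_dominated (hf : ∀ n, AEMeasurable (f n) μ)
    (hv : AEMeasurable v μ) (hlim : ∀ᵐ x ∂μ, Tendsto (fun n => f n x) atTop (𝓝 (v x)))
    {F : α → ℝ≥0∞} (hF : ∫⁻ x, F x ^ p ∂μ ≠ ⊤) (hfF : ∀ n, ∀ᵐ x ∂μ, ‖f n x‖ₑ ≤ F x)
    (hp : 0 < p) : Tendsto (fun n => ∫⁻ x, ‖f n x - v x‖ₑ ^ p ∂μ) atTop (𝓝 0) := by
  have hbound : ∫⁻ x, (2 * F x) ^ p ∂μ ≠ ⊤ := by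
    simp_rw [ENNReal.mul_rpow_of_nonneg _ _ hp.le]
    rw [lintegral_const_mul' _ _ (by finiteness)]
    exact ENNReal.mul_ne_top (by finiteness) hF
  rw [← lintegral_zero (μ := μ)]
  refine tendsto_lintegral_of_dominated_convergence' _
    (fun n => ((hf n).sub hv).enorm.pow_const p) (fun n => ?_) hbound ?_
  · filter_upwards [hlim, ae_all_iff.2 hfF] with x hx hxF
    have hvF : ‖v x‖ₑ ≤ F x := le_of_tendsto hx.enorm (Eventually.of_forall hxF)
    gcongr
    rw [two_mul]
    exact enorm_sub_le.trans (add_le_add (hxF n) hvF)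
  · filter_upwards [hlim] with x hx
    have hsub : Tendsto (fun n => ‖f n x - v x‖ₑ) atTop (𝓝 0) := by
      simpa using (hx.sub_const (v x)).enorm
    simpa [Function.comp_def, ENNReal.zero_rpow_of_pos hp] using
      ((ENNReal.continuous_rpow_const (y := p)).tendsto 0).comp hsub

lemma tendsto_lintegral_rpow_sub_of_tight (hf : ∀ n, AEMeasurable (f n) μ)
    (hlim : ∀ᵐ x ∂μ, Tendsto (fun n => f n x) atTop (𝓝 (v x))) (hp : 1 ≤ p)
    (htight : ∀ ε > 0, ∃ s, MeasurableSet s ∧ (∀ n, ∫⁻ x in sᶜ, ‖f n x‖ₑ ^ p ∂μ ≤ ε) ∧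
      ∃ F : α → ℝ≥0∞, ∫⁻ x in s, F x ^ p ∂μ ≠ ⊤ ∧ ∀ n, ∀ᵐ x ∂μ, ‖f n x‖ₑ ≤ F x) :
    Tendsto (fun n => ∫⁻ x, ‖f n x - v x‖ₑ ^ p ∂μ) atTop (𝓝 0) := by
  have hv := aemeasurable_of_tendsto_metrizable_ae _ hf hlim
  rw [ENNReal.tendsto_nhds_zero]
  intro ε hε
  have hε2 := ENNReal.half_pos hε.ne'
  have hpow : (2 : ℝ≥0∞) ^ p ≠ ⊤ := by finiteness
  obtain ⟨s, hs, hout, F, hF, hfF⟩ := htight (ε / 2 / 2 ^ p) (ENNReal.div_pos hε2.ne' hpow)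
  have hin := tendsto_lintegral_rpow_sub_of_dominated (fun n => (hf n).restrict) hv.restrict
    (ae_restrict_of_ae hlim) hF (fun n => ae_restrict_of_ae (hfF n)) (one_pos.trans_le hp)
  filter_upwards [ENNReal.tendsto_nhds_zero.1 hin (ε / 2) hε2] with n hn
  calc ∫⁻ x, ‖f n x - v x‖ₑ ^ p ∂μ
      = (∫⁻ x in s, ‖f n x - v x‖ₑ ^ p ∂μ) + ∫⁻ x in sᶜ, ‖f n x - v x‖ₑ ^ p ∂μ :=
        (lintegral_add_compl _ hs).symm
    _ ≤ ε / 2 + 2 ^ p * (ε / 2 / 2 ^ p) := by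
        gcongr
        exact lintegral_rpow_sub_le hv.restrict hp (hout n) <| lintegral_rpow_le_of_tendsto
          (fun n => (hf n).restrict) (ae_restrict_of_ae hlim) hout
    _ = ε := by
        rw [ENNReal.mul_div_cancel (by positivity) hpow, ENNReal.add_halves]

end Measure

namespace IsProfile

variable {w h : ℕ → ℝ → ℝ} {N : ℝ≥0} {p : ℝ} {u : ℕ → R3 → ℝ} {v : R3 → ℝ}

lemma exists_subseq_tendsto (hw : ∀ n, IsProfile (w n) (h n) N) :
    ∃ k : ℕ → ℕ, StrictMono k ∧ ∃ v : ℝ → ℝ,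
      ∀ t, 0 < t → Tendsto (fun n => w (k n) t) atTop (𝓝 (v t)) := by
  suffices hequi : Equicontinuous fun n (t : Ioi (0 : ℝ)) => w n t by
    obtain ⟨k, hk, l, hl⟩ := exists_subseq_tendsto_of_equicontinuous hequi
      fun n t => (hw n).abs_le t.2
    choose! v hv using fun t (ht : 0 < t) => (⟨_, hl ⟨t, ht⟩⟩ :
      ∃ l, Tendsto (fun n => w (k n) t) atTop (𝓝 l))
    exact ⟨k, hk, v, hv⟩
  intro t
  refine Metric.equicontinuousAt_of_continuity_modulus
    (fun s : Ioi (0 : ℝ) => N * √|(t : ℝ)⁻¹ - (s : ℝ)⁻¹|) ?_ _ ?_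
  · have hinv : ContinuousAt (fun s : Ioi (0 : ℝ) => (s : ℝ)⁻¹) t :=
      continuousAt_subtype_val.inv₀ t.2.ne'
    have hmod := ((hinv.tendsto.const_sub (t : ℝ)⁻¹).abs.sqrt).const_mul (N : ℝ)
    simpa using hmod
  · refine Eventually.of_forall fun s n => ?_
    rw [dist_comm]
    exact (hw n).abs_sub_le t.2 s.2

lemma exists_setLIntegral_rpow_le (hp : 18 / 7 < p) (N : ℝ≥0) {ε : ℝ≥0∞} (hε : 0 < ε) :
    ∃ R : ℝ, 0 < R ∧ ∀ {w h : ℝ → ℝ} {u : R3 → ℝ}, IsProfile w h N → (∀ᵐ x, u x = w ‖x‖) →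
      ∫⁻ x in norm ⁻¹' Ioi R, ‖u x‖ₑ ^ p ≤ ε := by
  set c : ℝ := 7 * (p - 2) / (7 * p - 18)
  have hdecay : Tendsto (fun R : ℝ => (volume : Measure R3).toSphere univ *
      (3 ^ (p - 2) * ENNReal.ofReal (c * R ^ ((18 - 7 * p) / 8)) * N ^ p)) atTop (𝓝 0) := by
    have hR : Tendsto (fun R : ℝ => c * R ^ ((18 - 7 * p) / 8)) atTop (𝓝 0) := by
      have := tendsto_rpow_neg_atTop (show 0 < (7 * p - 18) / 8 by linarith)
      simpa [← neg_div] using this.const_mul c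
    have hofReal := ENNReal.tendsto_ofReal hR
    rw [ENNReal.ofReal_zero] at hofReal
    have hconst : (3 : ℝ≥0∞) ^ (p - 2) ≠ ⊤ := by finiteness
    have hN : (N : ℝ≥0∞) ^ p ≠ ⊤ := by
      have : 0 ≤ p := by linarith
      finiteness
    have hsphere := measure_ne_top (volume : Measure R3).toSphere univ
    simpa using ENNReal.Tendsto.const_mul (ENNReal.Tendsto.mul_const
      (ENNReal.Tendsto.const_mul hofReal (.inr hconst)) (.inr hN)) (.inr hsphere)
  obtain ⟨R, hRε, hR⟩ :=
    ((ENNReal.tendsto_nhds_zero.1 hdecay ε hε).and (eventually_ge_atTop 1)).exists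
  have hR0 : 0 < R := one_pos.trans_le hR
  refine ⟨R, hR0, fun {w h u} hw hu => le_trans ?_ hRε⟩
  rw [hw.setLIntegral_rpow_eq hu measurableSet_Ioi, Ioi_inter_Ioi, max_eq_left hR0.le]
  gcongr
  exact hw.lintegral_rpow_Ioi_le hp hR

lemma setLIntegral_norm_rpow_ne_top (hp0 : 0 < p) (hp6 : p < 6) {R : ℝ} (hR : 0 < R) :
    ∫⁻ x in norm ⁻¹' Iic R, ENNReal.ofReal (N * ‖(x : R3)‖ ^ (-1 / 2 : ℝ)) ^ p ≠ ⊤ := by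
  rw [setLIntegral_comp_norm (volume : Measure R3)
    (f := fun t => ENNReal.ofReal (N * t ^ (-1 / 2 : ℝ)) ^ p) (by fun_prop) measurableSet_Iic,
    finrank_R3, inter_comm, Ioi_inter_Iic, setLIntegral_congr Ioo_ae_eq_Ioc.symm]
  refine ENNReal.mul_ne_top (measure_ne_top _ _) ?_
  calc ∫⁻ t in Ioo 0 R, ENNReal.ofReal (t ^ (3 - 1)) * ENNReal.ofReal (N * t ^ (-1 / 2 : ℝ)) ^ p
      = ∫⁻ t in Ioo 0 R, (N : ℝ≥0∞) ^ p * ENNReal.ofReal (t ^ (2 - p / 2)) := by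
        refine setLIntegral_congr_fun measurableSet_Ioo fun t ht => ?_
        have ht0 : 0 < t := ht.1
        have hpow : t ^ (2 - p / 2) = t ^ (3 - 1) * (t ^ (-1 / 2 : ℝ)) ^ p := by
          rw [← Real.rpow_natCast, ← Real.rpow_mul ht0.le, ← Real.rpow_add ht0]
          push_cast
          ring_nf
        rw [hpow, ENNReal.ofReal_mul N.coe_nonneg, ENNReal.ofReal_coe_nnreal,
          ENNReal.mul_rpow_of_nonneg _ _ hp0.le, ENNReal.ofReal_rpow_of_nonneg (by positivity)
          hp0.le, ENNReal.ofReal_mul (by positivity)]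
        exact mul_left_comm ..
    _ = (N : ℝ≥0∞) ^ p * ENNReal.ofReal (R ^ (2 - p / 2 + 1) / (2 - p / 2 + 1)) := by
        rw [lintegral_const_mul' _ _ (by finiteness), lintegral_rpow_Ioo (by linarith) hR.le]
    _ ≠ ⊤ := by finiteness

lemma tendsto_lintegral_rpow_sub (hw : ∀ n, IsProfile (w n) (h n) N)
    (hu : ∀ n, ∀ᵐ x, u n x = w n ‖x‖)
    (hv : ∀ᵐ x, Tendsto (fun n => u n x) atTop (𝓝 (v x))) (hum : ∀ n, AEMeasurable (u n))
    (hp : 18 / 7 < p) (hp6 : p < 6) :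
    Tendsto (fun n => ∫⁻ x, ‖u n x - v x‖ₑ ^ p) atTop (𝓝 0) := by
  refine tendsto_lintegral_rpow_sub_of_tight hum hv (by linarith) fun ε hε => ?_
  obtain ⟨R, hR0, hR⟩ := exists_setLIntegral_rpow_le hp N hε
  refine ⟨norm ⁻¹' Iic R, measurable_norm measurableSet_Iic, fun n => ?_,
    fun x => ENNReal.ofReal (N * ‖x‖ ^ (-1 / 2 : ℝ)),
    setLIntegral_norm_rpow_ne_top (by linarith) hp6 hR0, fun n => ?_⟩
  · rw [← preimage_compl, compl_Iic]
    exact hR (hw n) (hu n)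
  · filter_upwards [hu n, compl_mem_ae_iff.2 (measure_singleton (0 : R3))] with x hx hx0
    rw [hx, ← ofReal_norm, Real.norm_eq_abs]
    exact ENNReal.ofReal_le_ofReal ((hw n).abs_le (norm_pos_iff.2 hx0))

end IsProfile

theorem compact_inclusion (p : ℝ≥0∞) (hp : 18 / 7 < p) (hp6 : p < 6) (u : ℕ → R3 → ℝ)
    (hu : ∀ n, MemEr (u n)) (hM : ∃ M : ℝ≥0, ∀ n, normE (u n) ≤ M) :
    ∃ k : ℕ → ℕ, StrictMono k ∧ ∃ v : R3 → ℝ, MemLp v p volume ∧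
      Tendsto (fun n => eLpNorm (u (k n) - v) p volume) atTop (𝓝 0) := by
  obtain ⟨N, hN⟩ := hM
  obtain ⟨hpr, hpr6⟩ := toReal_mem_Ioc hp hp6.le
  have hp0 : p ≠ 0 := (zero_le.trans_lt hp).ne'
  have hpt : p ≠ ⊤ := (hp6.trans_le le_top).ne
  have hlt : p.toReal < 6 := by simpa using (ENNReal.toReal_lt_toReal hpt (by simp)).2 hp6
  have hpos : 0 < p.toReal := by linarith
  choose w h huw hw using fun n => (hu n).exists_profile (hN n)
  obtain ⟨k, hk, l, hl⟩ := IsProfile.exists_subseq_tendsto hw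
  have hum (n) : AEMeasurable (u (k n)) := (hu (k n)).memD12.memLp_six.1.aemeasurable
  have hlim : ∀ᵐ x : R3, Tendsto (fun n => u (k n) x) atTop (𝓝 (l ‖x‖)) := by
    filter_upwards [ae_all_iff.2 huw, compl_mem_ae_iff.2 (measure_singleton (0 : R3))] with x hx hx0
    simpa only [hx] using hl _ (norm_pos_iff.2 hx0)
  have hle := eLpNorm_le_of_lintegral_le hp0 hpt <| lintegral_rpow_le_of_tendsto hum hlim
    fun n => (hw (k n)).lintegral_rpow_le (huw (k n)) hpr hpr6
  refine ⟨k, hk, fun x => l ‖x‖,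
    ⟨(aemeasurable_of_tendsto_metrizable_ae _ hum hlim).aestronglyMeasurable,
      hle.trans_lt (by finiteness)⟩, ?_⟩
  have hpow := (ENNReal.continuous_rpow_const (y := 1 / p.toReal)).tendsto 0 |>.comp <|
    IsProfile.tendsto_lintegral_rpow_sub (fun n => hw (k n)) (fun n => huw (k n)) hlim hum hpr hlt
  rw [ENNReal.zero_rpow_of_pos (one_div_pos.2 hpos)] at hpow
  exact hpow.congr fun n => (eLpNorm_eq_lintegral_rpow_enorm_toReal hp0 hpt).symm

end Compactness

section ShellPotential

/-- A majorant of the Coulomb kernel `1 / ‖x - y‖` that serves all points `x` of the first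
coordinate axis. It is homogeneous of degree `-1` and integrable on the unit sphere. -/
noncomputable def axisKernel (y : R3) : ℝ≥0∞ :=
  ‖y 1‖ₑ ^ (-1 / 2 : ℝ) * ‖y 2‖ₑ ^ (-1 / 2 : ℝ)

lemma measurable_axisKernel : Measurable axisKernel := by
  unfold axisKernel
  fun_prop

lemma ofReal_one_div_norm_sub_le_axisKernel (t : ℝ) (y : R3) :
    ENNReal.ofReal (1 / ‖EuclideanSpace.single 0 t - y‖) ≤ axisKernel y := by
  set z : R3 := EuclideanSpace.single 0 t - y with hz
  have hpow (i : Fin 3) (hi : i ≠ 0) : ‖z‖ₑ ^ (-1 / 2 : ℝ) ≤ ‖y i‖ₑ ^ (-1 / 2 : ℝ) := by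
    have hzi : z i = -y i := by simp [hz, hi]
    have hle : ‖y i‖ₑ ≤ ‖z‖ₑ := by
      simpa only [hzi, enorm_neg] using enorm_le_iff_norm_le.2 (PiLp.norm_apply_le z i)
    rw [neg_div, ENNReal.rpow_neg, ENNReal.rpow_neg]
    gcongr
  rcases eq_or_ne z 0 with h0 | h0
  · simp [h0]
  calc ENNReal.ofReal (1 / ‖z‖) = ‖z‖ₑ ^ (-1 / 2 : ℝ) * ‖z‖ₑ ^ (-1 / 2 : ℝ) := by
        rw [← ENNReal.rpow_add _ _ (by simpa using h0) (by simp), one_div,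
          ENNReal.ofReal_inv_of_pos (norm_pos_iff.2 h0), ofReal_norm]
        norm_num [ENNReal.rpow_neg_one]
    _ ≤ axisKernel y := mul_le_mul' (hpow 1 (by decide)) (hpow 2 (by decide))

lemma axisKernel_smul {t : ℝ} (ht : 0 < t) (y : R3) :
    axisKernel (t • y) = (ENNReal.ofReal t)⁻¹ * axisKernel y := by
  have hcoord (i : Fin 3) : ‖(t • y) i‖ₑ ^ (-1 / 2 : ℝ) =
      ENNReal.ofReal t ^ (-1 / 2 : ℝ) * ‖y i‖ₑ ^ (-1 / 2 : ℝ) := by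
    rw [PiLp.smul_apply, smul_eq_mul, enorm_mul, Real.enorm_of_nonneg ht.le,
      ENNReal.mul_rpow_of_ne_top (by simp) (by simp)]
  rw [axisKernel, hcoord, hcoord, mul_mul_mul_comm,
    ← ENNReal.rpow_add _ _ (by simpa using ht) (by simp), ← ENNReal.rpow_neg_one, axisKernel]
  norm_num

lemma setLIntegral_axisKernel {s : Set ℝ} (hs : MeasurableSet s) :
    ∫⁻ y in norm ⁻¹' s, axisKernel y =
      (∫⁻ θ, axisKernel (θ : sphere (0 : R3) 1) ∂(volume : Measure R3).toSphere) *
        ∫⁻ t in s ∩ Ioi 0, ENNReal.ofReal t := by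
  set A := ∫⁻ θ, axisKernel (θ : sphere (0 : R3) 1) ∂(volume : Measure R3).toSphere
  have hcoe : Measurable fun θ : sphere (0 : R3) 1 => axisKernel θ :=
    measurable_axisKernel.comp measurable_subtype_coe
  have hsphere : ∀ᵐ t ∂radialMeasure 2, ∫⁻ θ : sphere (0 : R3) 1,
      (norm ⁻¹' s).indicator axisKernel (t • (θ : R3)) ∂(volume : Measure R3).toSphere =
        s.indicator (fun t => (ENNReal.ofReal t)⁻¹ * A) t := by
    refine (ae_radialMeasure_iff 2).2 ?_
    filter_upwards [ae_restrict_mem measurableSet_Ioi] with t ht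
    by_cases hts : t ∈ s
    · simp only [indicator, mem_preimage, norm_smul_sphere ht, hts, if_true, axisKernel_smul ht,
        lintegral_const_mul _ hcoe, A]
    · simp [indicator, norm_smul_sphere ht, hts]
  have hcancel : ∀ t ∈ Ioi (0 : ℝ),
      ENNReal.ofReal (t ^ 2) * s.indicator (fun t => (ENNReal.ofReal t)⁻¹ * A) t =
        A * s.indicator ENNReal.ofReal t := fun t (ht : 0 < t) => by
    by_cases hts : t ∈ s
    · rw [indicator_of_mem hts, indicator_of_mem hts, sq, ENNReal.ofReal_mul ht.le, mul_assoc,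
        ENNReal.mul_inv_cancel_left (by simpa using ht) (by simp), mul_comm]
    · simp [hts]
  rw [← lintegral_indicator (measurable_norm hs), lintegral_eq_lintegral_sphere volume
      (measurable_axisKernel.indicator (measurable_norm hs)).aemeasurable, finrank_R3,
    lintegral_congr_ae hsphere, lintegral_radialMeasure 2
      ((Measurable.indicator (by fun_prop) hs).aemeasurable),
    setLIntegral_congr_fun measurableSet_Ioi hcancel,
    lintegral_const_mul _ (ENNReal.measurable_ofReal.indicator hs), lintegral_indicator hs,
    Measure.restrict_restrict hs]

lemma setLIntegral_enorm_rpow_ne_top :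
    ∫⁻ s in norm ⁻¹' Iio (1 : ℝ), ‖(s : ℝ)‖ₑ ^ (-1 / 2 : ℝ) ≠ ⊤ := by
  have hnorm := setLIntegral_comp_norm (volume : Measure ℝ)
    (f := fun t => ENNReal.ofReal t ^ (-1 / 2 : ℝ)) (by fun_prop) measurableSet_Iio (s := Iio 1)
  have hpow : ∫⁻ t in Ioo (0 : ℝ) 1, ENNReal.ofReal t ^ (-1 / 2 : ℝ) ≠ ⊤ := by
    rw [setLIntegral_congr_fun measurableSet_Ioo fun t ht => ENNReal.ofReal_rpow_of_pos ht.1,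
      lintegral_rpow_Ioo (by norm_num) zero_le_one]
    finiteness
  simp only [ofReal_norm, Module.finrank_self, tsub_self, pow_zero, ENNReal.ofReal_one, one_mul,
    Iio_inter_Ioi] at hnorm
  rw [hnorm]
  exact ENNReal.mul_ne_top (measure_ne_top (volume : Measure ℝ).toSphere univ) hpow

lemma setLIntegral_axisKernel_ball_ne_top : ∫⁻ y in norm ⁻¹' Iio 1, axisKernel y ≠ ⊤ := by
  set φ : ℝ → ℝ≥0∞ := (norm ⁻¹' Iio 1).indicator fun s => ‖s‖ₑ ^ (-1 / 2 : ℝ) with hφ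
  have hφm : Measurable φ := Measurable.indicator (by fun_prop) (measurable_norm measurableSet_Iio)
  have hle : ∀ y ∈ norm ⁻¹' Iio 1, axisKernel y ≤ ∏ i, φ ((y : R3) i) := fun y (hy : ‖y‖ < 1) => by
    have hcoord (i : Fin 3) : ‖y i‖ < 1 := (PiLp.norm_apply_le y i).trans_lt hy
    have hφy (i : Fin 3) : φ (y i) = ‖y i‖ₑ ^ (-1 / 2 : ℝ) :=
      indicator_of_mem (show y i ∈ norm ⁻¹' Iio 1 from hcoord i) _
    have h0 : 1 ≤ ‖y 0‖ₑ ^ (-1 / 2 : ℝ) := by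
      rw [neg_div, ENNReal.rpow_neg, ENNReal.one_le_inv]
      refine ENNReal.rpow_le_one ?_ (by norm_num)
      simpa using (enorm_le_iff_norm_le (x := y 0) (y := (1 : ℝ))).2 (by simpa using (hcoord 0).le)
    rw [Fin.prod_univ_three, hφy, hφy, hφy, mul_assoc]
    exact le_mul_of_one_le_left' h0
  have hprod : ∫⁻ y : R3, ∏ i, φ (y i) = ∏ _i : Fin 3, ∫⁻ s, φ s :=
    ((PiLp.volume_preserving_ofLp (Fin 3)).lintegral_comp
      (f := fun y : Fin 3 → ℝ => ∏ i, φ (y i)) (by fun_prop)).trans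
      (lintegral_fin_prod_eq_prod fun _ => hφm)
  have hfin : ∫⁻ s, φ s ≠ ⊤ := by
    rw [hφ, lintegral_indicator (measurable_norm measurableSet_Iio)]
    exact setLIntegral_enorm_rpow_ne_top
  refine ne_top_of_le_ne_top ?_ ((setLIntegral_mono' (measurable_norm measurableSet_Iio) hle).trans
    (setLIntegral_le_lintegral _ _))
  rw [hprod]
  exact ENNReal.prod_ne_top fun _ _ => hfin

lemma lintegral_sphere_axisKernel_ne_top :
    ∫⁻ θ, axisKernel (θ : sphere (0 : R3) 1) ∂(volume : Measure R3).toSphere ≠ ⊤ := by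
  intro htop
  refine setLIntegral_axisKernel_ball_ne_top ?_
  have hpos := lintegral_rpow_Ioo (a := 1) (by norm_num) zero_le_one
  simp only [Real.rpow_one] at hpos
  rw [setLIntegral_axisKernel measurableSet_Iio, htop, Iio_inter_Ioi, hpos]
  norm_num

lemma setLIntegral_one_div_norm_sub_eq (x : R3) (s : Set ℝ) :
    ∫⁻ y in norm ⁻¹' s, ENNReal.ofReal (1 / ‖x - y‖) =
      ∫⁻ y in norm ⁻¹' s, ENNReal.ofReal (1 / ‖(EuclideanSpace.single 0 ‖x‖ : R3) - y‖) := by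
  obtain ⟨ρ, hρ⟩ : ∃ ρ : R3 ≃ₗᵢ[ℝ] R3, ρ x = EuclideanSpace.single 0 ‖x‖ :=
    ⟨_, Submodule.reflection_sub (by simp)⟩
  have hpre : ρ ⁻¹' (norm ⁻¹' s) = norm ⁻¹' s := by ext y; simp
  have h := ρ.measurePreserving.setLIntegral_comp_preimage_emb
    ρ.toHomeomorph.measurableEmbedding (fun y => ENNReal.ofReal (1 / ‖ρ x - y‖)) (norm ⁻¹' s)
  simp only [hpre, ← map_sub, ρ.norm_map] at h
  rw [h, hρ]

lemma exists_setLIntegral_one_div_norm_sub_le : ∃ C : ℝ≥0, ∀ (x : R3) (R l : ℝ), 0 < l → l ≤ R →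
    ∫⁻ y in norm ⁻¹' Ioc R (R + l), ENNReal.ofReal (1 / ‖x - y‖) ≤
      C * ENNReal.ofReal (R * l) := by
  set A := ∫⁻ θ, axisKernel (θ : sphere (0 : R3) 1) ∂(volume : Measure R3).toSphere
  have hA : A ≠ ⊤ := lintegral_sphere_axisKernel_ne_top
  refine ⟨(2 * A).toNNReal, fun x R l hl hlR => ?_⟩
  rw [ENNReal.coe_toNNReal (by finiteness)]
  calc ∫⁻ y in norm ⁻¹' Ioc R (R + l), ENNReal.ofReal (1 / ‖x - y‖)
      ≤ ∫⁻ y in norm ⁻¹' Ioc R (R + l), axisKernel y := by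
        rw [setLIntegral_one_div_norm_sub_eq]
        exact lintegral_mono fun y => ofReal_one_div_norm_sub_le_axisKernel _ y
    _ = A * ∫⁻ t in Ioc R (R + l) ∩ Ioi 0, ENNReal.ofReal t :=
        setLIntegral_axisKernel measurableSet_Ioc
    _ ≤ A * ∫⁻ t in Ioc R (R + l), ENNReal.ofReal t := by
        gcongr
        exact inter_subset_left
    _ ≤ A * ∫⁻ _ in Ioc R (R + l), ENNReal.ofReal (2 * R) := by
        refine mul_le_mul_right (setLIntegral_mono' measurableSet_Ioc fun t ht => ?_) A
        exact ENNReal.ofReal_le_ofReal (by linarith [ht.2])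
    _ = 2 * A * ENNReal.ofReal (R * l) := by
        rw [setLIntegral_const, Real.volume_Ioc, add_sub_cancel_left,
          ← ENNReal.ofReal_mul (by linarith), mul_assoc 2 R, ENNReal.ofReal_mul zero_le_two,
          ENNReal.ofReal_ofNat]
        ring

lemma energy_eq (u : R3 → ℝ) : energy u = ∫⁻ x, ENNReal.ofReal (u x ^ 2) *
    ∫⁻ y, ENNReal.ofReal (u y ^ 2) * ENNReal.ofReal (1 / ‖x - y‖) := by
  refine lintegral_congr fun x => ?_
  rw [← lintegral_const_mul' _ _ ENNReal.ofReal_ne_top]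
  refine lintegral_congr fun y => ?_
  rw [← ENNReal.ofReal_mul (sq_nonneg _), ← ENNReal.ofReal_mul (sq_nonneg _), ← mul_assoc,
    mul_one_div]

lemma sq_mul_le_rpow_mul_rpow {a b : ℝ} (ha : 0 < a) (hab : a ≤ b) :
    a ^ 2 * b ≤ a ^ (3 / 2 : ℝ) * b ^ (3 / 2 : ℝ) := by
  have hb := ha.trans_le hab
  have hsplit {c : ℝ} (hc : 0 < c) : c ^ (3 / 2 : ℝ) = c * √c := by
    rw [Real.sqrt_eq_rpow, ← Real.rpow_one_add' hc.le (by norm_num)]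
    norm_num
  calc a ^ 2 * b = a * b * (√a * √a) := by rw [Real.mul_self_sqrt ha.le]; ring
    _ ≤ a * b * (√a * √b) := by gcongr
    _ = a ^ (3 / 2 : ℝ) * b ^ (3 / 2 : ℝ) := by rw [hsplit ha, hsplit hb]; ring

end ShellPotential

section WeakGradientOfContDiff

lemma isWeakGradient_of_contDiff {u : R3 → ℝ} {g : R3 → R3} (hu : ContDiff ℝ 1 u)
    (hg : ∀ x i, fderiv ℝ u x (EuclideanSpace.single i 1) = g x i) : IsWeakGradient u g := by
  have hcoord (i : Fin 3) : Continuous fun x => fderiv ℝ u x (EuclideanSpace.single i 1) :=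
    (hu.continuous_fderiv one_ne_zero).clm_apply continuous_const
  have hcont : Continuous g :=
    (PiLp.continuous_toLp 2 _).comp (continuous_pi fun i => (hcoord i).congr fun x => hg x i)
  refine ⟨hu.continuous.locallyIntegrable, hcont.locallyIntegrable, fun φ hφ hφc i => ?_⟩
  have hφ' : Continuous fun x => fderiv ℝ φ x (EuclideanSpace.single i 1) :=
    (hφ.continuous_fderiv (by simp)).clm_apply continuous_const
  simp_rw [← hg]
  refine integral_mul_fderiv_eq_neg_fderiv_mul_of_integrable
    (((hcoord i).mul hφ.continuous).integrable_of_hasCompactSupport hφc.mul_left)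
    ((hu.continuous.mul hφ').integrable_of_hasCompactSupport (hφc.fderiv_apply ℝ _).mul_left)
    ((hu.continuous.mul hφ.continuous).integrable_of_hasCompactSupport hφc.mul_left)
    (fun x _ => hu.differentiable one_ne_zero x) fun x _ => hφ.differentiable (by simp) x

end WeakGradientOfContDiff

section Bump

/-- The model profile of a shell: a smooth bump on `[0, 1]` that is `1` in the middle. -/
noncomputable def bump : ContDiffBump (1 / 2 : ℝ) := ⟨1 / 4, 1 / 2, by norm_num, by norm_num⟩

lemma bump_eq_zero {t : ℝ} (ht : t ∉ Ioo (0 : ℝ) 1) : bump t = 0 := by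
  refine bump.zero_of_le_dist ?_
  rw [Real.dist_eq, ← not_lt, abs_lt]
  change ¬(-(1 / 2) < t - 1 / 2 ∧ t - 1 / 2 < 1 / 2)
  exact fun h => ht ⟨by linarith [h.1], by linarith [h.2]⟩

lemma bump_eq_one {t : ℝ} (ht : t ∈ Icc (1 / 4 : ℝ) (3 / 4)) : bump t = 1 := by
  refine bump.one_of_mem_closedBall ?_
  rw [Real.closedBall_eq_Icc]
  exact ⟨by linarith [ht.1, show bump.rIn = 1 / 4 from rfl],
    by linarith [ht.2, show bump.rIn = 1 / 4 from rfl]⟩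

lemma deriv_bump_eq_zero {t : ℝ} (ht : t ∉ Ioo (0 : ℝ) 1) : deriv bump t = 0 :=
  IsLocalMin.deriv_eq_zero (.of_forall fun _ => (bump_eq_zero ht).trans_le bump.nonneg)

lemma exists_norm_deriv_bump_le : ∃ L : ℝ, ∀ t, ‖deriv bump t‖ ≤ L :=
  ((bump.contDiff (n := 1)).continuous_deriv le_rfl).bounded_above_of_compact_support
    bump.hasCompactSupport.deriv

end Bump

section ShellVolume

lemma volume_preimage_norm {s : Set ℝ} (hs : MeasurableSet s) :
    volume (norm ⁻¹' s : Set R3) = (volume : Measure R3).toSphere univ *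
      ∫⁻ t in s ∩ Ioi 0, ENNReal.ofReal (t ^ 2) := by
  simpa using setLIntegral_comp_norm (volume : Measure R3) (f := 1) aemeasurable_one hs

lemma volume_preimage_norm_Ioc_le (a b : ℝ) :
    volume (norm ⁻¹' Ioc a b : Set R3) ≤
      (volume : Measure R3).toSphere univ * ENNReal.ofReal (b ^ 2 * (b - a)) := by
  rw [volume_preimage_norm measurableSet_Ioc]
  gcongr
  calc ∫⁻ t in Ioc a b ∩ Ioi 0, ENNReal.ofReal (t ^ 2)
      ≤ ∫⁻ _ in Ioc a b ∩ Ioi 0, ENNReal.ofReal (b ^ 2) :=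
        setLIntegral_mono' (measurableSet_Ioc.inter measurableSet_Ioi) fun t ht =>
          ENNReal.ofReal_le_ofReal (pow_le_pow_left₀ (le_of_lt ht.2) ht.1.2 2)
    _ ≤ ∫⁻ _ in Ioc a b, ENNReal.ofReal (b ^ 2) := lintegral_mono_set inter_subset_left
    _ = ENNReal.ofReal (b ^ 2 * (b - a)) := by
        rw [setLIntegral_const, Real.volume_Ioc, ENNReal.ofReal_mul (sq_nonneg b)]

lemma le_volume_preimage_norm_Ioc {a : ℝ} (ha : 0 ≤ a) (b : ℝ) :
    (volume : Measure R3).toSphere univ * ENNReal.ofReal (a ^ 2 * (b - a)) ≤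
      volume (norm ⁻¹' Ioc a b : Set R3) := by
  rw [volume_preimage_norm measurableSet_Ioc,
    inter_eq_left.2 (Ioc_subset_Ioi_self.trans (Ioi_subset_Ioi ha))]
  gcongr
  calc ENNReal.ofReal (a ^ 2 * (b - a)) = ∫⁻ _ in Ioc a b, ENNReal.ofReal (a ^ 2) := by
        rw [setLIntegral_const, Real.volume_Ioc, ENNReal.ofReal_mul (sq_nonneg a)]
    _ ≤ ∫⁻ t in Ioc a b, ENNReal.ofReal (t ^ 2) :=
        setLIntegral_mono' measurableSet_Ioc fun t ht =>
          ENNReal.ofReal_le_ofReal (pow_le_pow_left₀ ha ht.1.le 2)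

end ShellVolume

/-- Pairwise disjoint spherical shells with inner radii `R k` and thicknesses `l k`, carrying
heights `h k`. Sums of bumps of height `h k` on these shells are the functions that show that `E_r`
is not contained in `L^p`. -/
structure Shells where
  R : ℕ → ℝ
  l : ℕ → ℝ
  h : ℕ → ℝ
  l_pos : ∀ k, 0 < l k
  l_le : ∀ k, l k ≤ R k
  h_pos : ∀ k, 0 < h k
  disjoint : Pairwise fun j k => Disjoint (Ioc (R j) (R j + l j)) (Ioc (R k) (R k + l k))

namespace Shells

variable (s : Shells)

/-- The `k`-th shell, as a subset of `ℝ³`. -/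
def shell (k : ℕ) : Set R3 := norm ⁻¹' Ioc (s.R k) (s.R k + s.l k)

/-- The bump on the `k`-th shell, as a function of the radius. -/
noncomputable def profile (k : ℕ) (r : ℝ) : ℝ := s.h k * bump ((r - s.R k) / s.l k)

/-- The bump on the `k`-th shell. -/
noncomputable def term (k : ℕ) (x : R3) : ℝ := s.profile k ‖x‖

/-- The gradient of the bump on the `k`-th shell. -/
noncomputable def termGrad (k : ℕ) (x : R3) : R3 := (deriv (s.profile k) ‖x‖ / ‖x‖) • x

/-- The sum of the bumps, which is the counterexample to the inclusion. -/
noncomputable def sum (x : R3) : ℝ := ∑' k, s.term k x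

/-- The gradient of the sum of the bumps. -/
noncomputable def sumGrad (x : R3) : R3 := ∑' k, s.termGrad k x

variable {s}

lemma R_pos (k : ℕ) : 0 < s.R k := (s.l_pos k).trans_le (s.l_le k)

lemma measurableSet_shell (k : ℕ) : MeasurableSet (s.shell k) := measurable_norm measurableSet_Ioc

lemma volume_shell_le (k : ℕ) : volume (s.shell k) ≤
    4 * (volume : Measure R3).toSphere univ * ENNReal.ofReal (s.R k ^ 2 * s.l k) := by
  have hl := s.l_pos k
  have hR : 0 < s.R k := R_pos k
  have hle : (s.R k + s.l k) ^ 2 * s.l k ≤ 4 * (s.R k ^ 2 * s.l k) := by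
    nlinarith [show (s.R k + s.l k) ^ 2 ≤ 4 * s.R k ^ 2 by nlinarith [s.l_le k]]
  calc volume (s.shell k)
      ≤ (volume : Measure R3).toSphere univ * ENNReal.ofReal ((s.R k + s.l k) ^ 2 * s.l k) := by
        refine (volume_preimage_norm_Ioc_le (s.R k) (s.R k + s.l k)).trans_eq ?_
        rw [add_sub_cancel_left]
    _ ≤ (volume : Measure R3).toSphere univ * ENNReal.ofReal (4 * (s.R k ^ 2 * s.l k)) := by
        gcongr
    _ = 4 * (volume : Measure R3).toSphere univ * ENNReal.ofReal (s.R k ^ 2 * s.l k) := by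
        rw [ENNReal.ofReal_mul zero_le_four, ENNReal.ofReal_ofNat]
        ring

section Disjoint

variable {E : Type*} [NormedAddCommGroup E] {f : ℕ → R3 → E}

lemma exists_forall_ne_eq_zero (hf : ∀ k, ∀ x ∉ s.shell k, f k x = 0) (x : R3) :
    ∃ k, ∀ j ≠ k, f j x = 0 := by
  by_cases! h : ∃ k, x ∈ s.shell k
  · obtain ⟨k, hk⟩ := h
    exact ⟨k, fun j hj => hf j x fun hx => disjoint_left.1 (s.disjoint hj) hx hk⟩
  · exact ⟨0, fun j _ => hf j x (h j)⟩

lemma hasSum_tsum (hf : ∀ k, ∀ x ∉ s.shell k, f k x = 0) (x : R3) :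
    HasSum (fun k => f k x) (∑' k, f k x) := by
  obtain ⟨k, hk⟩ := exists_forall_ne_eq_zero hf x
  exact (hasSum_single k hk).summable.hasSum

lemma aestronglyMeasurable_tsum (hf : ∀ k, ∀ x ∉ s.shell k, f k x = 0)
    (hfm : ∀ k, AEStronglyMeasurable (f k)) : AEStronglyMeasurable fun x => ∑' k, f k x :=
  aestronglyMeasurable_of_tendsto_ae atTop
    (fun n => Finset.aestronglyMeasurable_fun_sum (Finset.range n) fun k _ => hfm k)
    (ae_of_all _ fun x => (hasSum_tsum hf x).tendsto_sum_nat)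

lemma comp_tsum (hf : ∀ k, ∀ x ∉ s.shell k, f k x = 0) {G : E → ℝ≥0∞} (hG : G 0 = 0) (x : R3) :
    G (∑' k, f k x) = ∑' k, G (f k x) := by
  obtain ⟨k, hk⟩ := exists_forall_ne_eq_zero hf x
  rw [tsum_eq_single k hk, tsum_eq_single k fun j hj => by rw [hk j hj, hG]]

lemma lintegral_comp_tsum_mul_le (hf : ∀ k, ∀ x ∉ s.shell k, f k x = 0) {G : E → ℝ≥0∞}
    (hG : G 0 = 0) {a : ℕ → ℝ≥0∞} (ha : ∀ k x, G (f k x) ≤ a k) {F : R3 → ℝ≥0∞}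
    (hF : Measurable F) :
    ∫⁻ x, G (∑' k, f k x) * F x ≤ ∑' k, a k * ∫⁻ x in s.shell k, F x := by
  calc ∫⁻ x, G (∑' k, f k x) * F x
      ≤ ∫⁻ x, ∑' k, (s.shell k).indicator (fun y => a k * F y) x := by
        refine lintegral_mono fun x => ?_
        rw [comp_tsum hf hG, ← ENNReal.tsum_mul_right]
        refine ENNReal.tsum_le_tsum fun k => ?_
        by_cases hx : x ∈ s.shell k
        · rw [indicator_of_mem hx]
          exact mul_le_mul_left (ha k x) (F x)
        · rw [hf k x hx, hG, zero_mul]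
          exact zero_le
    _ = ∑' k, a k * ∫⁻ x in s.shell k, F x := by
        rw [lintegral_tsum fun k =>
          ((hF.const_mul _).indicator (measurableSet_shell k)).aemeasurable]
        refine tsum_congr fun k => ?_
        rw [lintegral_indicator (measurableSet_shell k), lintegral_const_mul _ hF]

lemma memLp_tsum (hf : ∀ k, ∀ x ∉ s.shell k, f k x = 0) (hfm : ∀ k, AEStronglyMeasurable (f k))
    {c : ℕ → ℝ} (hc : ∀ k x, ‖f k x‖ ≤ c k) {q : ℝ≥0∞} (hq0 : q ≠ 0) (hqt : q ≠ ⊤)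
    (hsum : Summable fun k => c k ^ q.toReal * (s.R k ^ 2 * s.l k)) :
    MemLp (fun x => ∑' k, f k x) q := by
  have hq := ENNReal.toReal_pos hq0 hqt
  have hc0 (k : ℕ) : 0 ≤ c k := (norm_nonneg _).trans (hc k 0)
  have hle := lintegral_comp_tsum_mul_le (F := 1) hf (G := fun y => ‖y‖ₑ ^ q.toReal)
    (a := fun k => ENNReal.ofReal (c k ^ q.toReal)) (by simp [hq]) (fun k x => by
      rw [← ENNReal.ofReal_rpow_of_nonneg (hc0 k) hq.le, ← ofReal_norm]
      gcongr
      exact hc k x) measurable_one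
  refine ⟨aestronglyMeasurable_tsum hf hfm,
    (eLpNorm_lt_top_iff_lintegral_rpow_enorm_lt_top hq0 hqt).2 ?_⟩
  calc ∫⁻ x, ‖∑' k, f k x‖ₑ ^ q.toReal
      ≤ ∑' k, ENNReal.ofReal (c k ^ q.toReal) * volume (s.shell k) := by simpa using hle
    _ ≤ ∑' k, 4 * (volume : Measure R3).toSphere univ *
          ENNReal.ofReal (c k ^ q.toReal * (s.R k ^ 2 * s.l k)) := by
        refine ENNReal.tsum_le_tsum fun k => ?_
        rw [ENNReal.ofReal_mul (Real.rpow_nonneg (hc0 k) _), mul_left_comm]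
        gcongr
        exact volume_shell_le k
    _ < ⊤ := by
        rw [ENNReal.tsum_mul_left]
        have := hsum.tsum_ofReal_ne_top
        finiteness

end Disjoint

section Term

variable {k : ℕ}

lemma scaled_notMem {r : ℝ} (hr : r ∉ Ioc (s.R k) (s.R k + s.l k)) :
    (r - s.R k) / s.l k ∉ Ioo (0 : ℝ) 1 := by
  rintro ⟨h0, h1⟩
  have hl := s.l_pos k
  rw [lt_div_iff₀ hl] at h0
  rw [div_lt_one hl] at h1
  exact hr ⟨by linarith, by linarith⟩

lemma profile_eq_zero {r : ℝ} (hr : r ∉ Ioc (s.R k) (s.R k + s.l k)) : s.profile k r = 0 := by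
  rw [profile, bump_eq_zero (scaled_notMem hr), mul_zero]

lemma zero_notMem_tsupport_profile : 0 ∉ tsupport (s.profile k) := by
  rw [notMem_tsupport_iff_eventuallyEq]
  filter_upwards [Iio_mem_nhds (R_pos k)] with r hr
  exact profile_eq_zero fun h => h.1.not_gt hr

lemma contDiff_profile : ContDiff ℝ ∞ (s.profile k) :=
  contDiff_const.mul (bump.contDiff.comp ((contDiff_id.sub contDiff_const).div_const _))

lemma deriv_profile (r : ℝ) :
    deriv (s.profile k) r = s.h k / s.l k * deriv bump ((r - s.R k) / s.l k) := by
  have hb : HasDerivAt bump (deriv bump ((r - s.R k) / s.l k)) ((r - s.R k) / s.l k) :=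
    ((bump.contDiff (n := 1)).differentiable one_ne_zero _).hasDerivAt
  have h := (hb.comp r (((hasDerivAt_id r).sub_const (s.R k)).div_const (s.l k))).const_mul (s.h k)
  exact h.deriv.trans (by ring)

lemma term_eq_zero (k : ℕ) (x : R3) (hx : x ∉ s.shell k) : s.term k x = 0 :=
  profile_eq_zero hx

lemma termGrad_eq_zero (k : ℕ) (x : R3) (hx : x ∉ s.shell k) : s.termGrad k x = 0 := by
  rw [termGrad, deriv_profile, deriv_bump_eq_zero (scaled_notMem hx), mul_zero, zero_div, zero_smul]

lemma contDiff_term : ContDiff ℝ ∞ (s.term k) :=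
  contDiff_comp_norm contDiff_profile zero_notMem_tsupport_profile

lemma norm_term_le (k : ℕ) (x : R3) : ‖s.term k x‖ ≤ s.h k := by
  rw [term, profile, Real.norm_of_nonneg (mul_nonneg (s.h_pos k).le bump.nonneg)]
  exact mul_le_of_le_one_right (s.h_pos k).le bump.le_one

lemma norm_termGrad_le {L : ℝ} (hL : ∀ t, ‖deriv bump t‖ ≤ L) (k : ℕ) (x : R3) :
    ‖s.termGrad k x‖ ≤ s.h k / s.l k * L := by
  have hhl : 0 ≤ s.h k / s.l k := (div_pos (s.h_pos k) (s.l_pos k)).le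
  calc ‖s.termGrad k x‖ = ‖deriv (s.profile k) ‖x‖‖ * (‖x‖ / ‖x‖) := by
        rw [termGrad, norm_smul, norm_div, norm_norm, div_mul_eq_mul_div, mul_div_assoc]
    _ ≤ ‖deriv (s.profile k) ‖x‖‖ := mul_le_of_le_one_right (norm_nonneg _) (div_self_le_one _)
    _ ≤ s.h k / s.l k * L := by
        rw [deriv_profile, norm_mul, Real.norm_of_nonneg hhl]
        exact mul_le_mul_of_nonneg_left (hL _) hhl

lemma aestronglyMeasurable_termGrad (k : ℕ) : AEStronglyMeasurable (s.termGrad k) := by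
  have hd : Measurable (deriv (s.profile k)) := measurable_deriv _
  exact (((hd.comp measurable_norm).div measurable_norm).smul measurable_id).aestronglyMeasurable

lemma fderiv_term (x : R3) (i : Fin 3) :
    fderiv ℝ (s.term k) x (EuclideanSpace.single i 1) = s.termGrad k x i := by
  rcases eq_or_ne x 0 with rfl | hx
  · have h0 : s.term k =ᶠ[𝓝 0] 0 := by
      filter_upwards [ball_mem_nhds 0 (R_pos k)] with x hx
      exact term_eq_zero k x fun h => h.1.not_gt (mem_ball_zero_iff.1 hx)
    rw [h0.fderiv_eq]
    simp [termGrad]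
  · have hd : HasDerivAt (s.profile k) (deriv (s.profile k) ‖x‖) ‖x‖ :=
      (contDiff_profile.differentiable (by simp) _).hasDerivAt
    have hf : HasFDerivAt (s.term k) ((deriv (s.profile k) ‖x‖ / ‖x‖) • innerSL ℝ x) x :=
      hasFDerivAt_comp_norm hx hd
    rw [hf.fderiv]
    simp [termGrad, EuclideanSpace.inner_single_right]

lemma isWeakGradient_term (k : ℕ) : IsWeakGradient (s.term k) (s.termGrad k) :=
  isWeakGradient_of_contDiff (contDiff_term.of_le (by simp)) fderiv_term

end Term

section Sum

lemma integral_tsum_mul {f : ℕ → R3 → ℝ} (hf : ∀ k, ∀ x ∉ s.shell k, f k x = 0)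
    (hfm : ∀ k, AEStronglyMeasurable (f k)) (hloc : LocallyIntegrable fun x => ∑' k, f k x)
    {ψ : R3 → ℝ} (hψ : Continuous ψ) (hψc : HasCompactSupport ψ) :
    ∫ x, (∑' k, f k x) * ψ x = ∑' k, ∫ x, f k x * ψ x := by
  have hm (k : ℕ) : AEStronglyMeasurable fun x => f k x * ψ x :=
    (hfm k).mul hψ.aestronglyMeasurable
  have henorm : ∫⁻ x, ‖(∑' k, f k x) * ψ x‖ₑ = ∑' k, ∫⁻ x, ‖f k x * ψ x‖ₑ := by
    rw [← lintegral_tsum fun k => (hm k).enorm]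
    exact lintegral_congr fun x => comp_tsum hf (G := fun t => ‖t * ψ x‖ₑ) (by simp) x
  have hfin := (integrable_mul_of_hasCompactSupport hloc hψ hψc).hasFiniteIntegral
  rw [HasFiniteIntegral, henorm] at hfin
  rw [← integral_tsum hm hfin.ne]
  simp_rw [tsum_mul_right]

lemma isWeakGradient_sum (hu : LocallyIntegrable s.sum) (hg : LocallyIntegrable s.sumGrad) :
    IsWeakGradient s.sum s.sumGrad := by
  refine ⟨hu, hg, fun φ hφ hφc i => ?_⟩
  have hcoord (x : R3) : s.sumGrad x i = ∑' k, s.termGrad k x i :=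
    ((hasSum_tsum termGrad_eq_zero x).mapL (EuclideanSpace.proj (𝕜 := ℝ) i)).tsum_eq.symm
  have hφ' : Continuous fun x => fderiv ℝ φ x (EuclideanSpace.single i 1) :=
    (hφ.continuous_fderiv (by simp)).clm_apply continuous_const
  have hloc := locallyIntegrable_coord hg i
  simp_rw [hcoord] at hloc
  calc ∫ x, s.sum x * fderiv ℝ φ x (EuclideanSpace.single i 1)
      = ∑' k, ∫ x, s.term k x * fderiv ℝ φ x (EuclideanSpace.single i 1) :=
        integral_tsum_mul term_eq_zero (fun k => contDiff_term.continuous.aestronglyMeasurable) hu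
          hφ' (hφc.fderiv_apply ℝ _)
    _ = ∑' k, -∫ x, s.termGrad k x i * φ x :=
        tsum_congr fun k => (isWeakGradient_term k).integral_eq φ hφ hφc i
    _ = -∫ x, s.sumGrad x i * φ x := by
        simp_rw [hcoord]
        rw [tsum_neg, integral_tsum_mul (s := s) (f := fun k x => s.termGrad k x i)
          (fun k x hx => by simp [termGrad_eq_zero k x hx])
          (fun k => (EuclideanSpace.proj (𝕜 := ℝ) i).continuous.comp_aestronglyMeasurable
            (aestronglyMeasurable_termGrad k)) hloc hφ.continuous hφc]

lemma memLp_six_sum (hsum : Summable fun k => s.h k ^ 6 * (s.R k ^ 2 * s.l k)) :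
    MemLp s.sum 6 := by
  refine memLp_tsum term_eq_zero (fun k => contDiff_term.continuous.aestronglyMeasurable)
    norm_term_le (by simp) (by simp) ?_
  simpa using hsum

lemma memLp_two_sumGrad (hsum : Summable fun k => s.h k ^ 2 * s.R k ^ 2 / s.l k) :
    MemLp s.sumGrad 2 := by
  obtain ⟨L, hL⟩ := exists_norm_deriv_bump_le
  refine memLp_tsum termGrad_eq_zero aestronglyMeasurable_termGrad (norm_termGrad_le hL)
    (by simp) (by simp) ((hsum.mul_left (L ^ 2)).congr fun k => ?_)
  have hl := (s.l_pos k).ne'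
  rw [ENNReal.toReal_ofNat, Real.rpow_ofNat]
  field_simp

lemma isRadial_sum (s : Shells) : IsRadial s.sum :=
  ⟨fun r => ∑' k, s.profile k r, ae_of_all _ fun _ => rfl⟩

end Sum

section Energy

/-- The mutual Coulomb energy of two shells carrying unit charge density. -/
noncomputable def mutualEnergy (s : Shells) (j k : ℕ) : ℝ≥0∞ :=
  ∫⁻ x in s.shell j, ∫⁻ y in s.shell k, ENNReal.ofReal (1 / ‖x - y‖)

lemma mutualEnergy_comm (j k : ℕ) : s.mutualEnergy j k = s.mutualEnergy k j := by
  unfold mutualEnergy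
  rw [lintegral_lintegral_swap (by fun_prop)]
  simp_rw [norm_sub_rev]

lemma exists_mutualEnergy_le : ∃ C : ℝ≥0, ∀ (s : Shells) (j k : ℕ), s.mutualEnergy j k ≤
    C * (ENNReal.ofReal (s.R j ^ (3 / 2 : ℝ) * s.l j) *
      ENNReal.ofReal (s.R k ^ (3 / 2 : ℝ) * s.l k)) := by
  obtain ⟨C, hC⟩ := exists_setLIntegral_one_div_norm_sub_le
  set S := (volume : Measure R3).toSphere univ
  have hS : S ≠ ⊤ := measure_ne_top _ _
  refine ⟨C * (4 * S).toNNReal, fun s j k => ?_⟩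
  rw [ENNReal.coe_mul, ENNReal.coe_toNNReal (by finiteness)]
  wlog hjk : s.R j ≤ s.R k generalizing j k
  · rw [mutualEnergy_comm, mul_comm (ENNReal.ofReal _)]
    exact this k j (le_of_not_ge hjk)
  have hRj : 0 < s.R j := R_pos j
  have hlj := s.l_pos j
  have hlk := s.l_pos k
  calc s.mutualEnergy j k
      ≤ ∫⁻ _ in s.shell j, C * ENNReal.ofReal (s.R k * s.l k) :=
        lintegral_mono fun x => hC x _ _ hlk (s.l_le k)
    _ ≤ C * ENNReal.ofReal (s.R k * s.l k) * (4 * S * ENNReal.ofReal (s.R j ^ 2 * s.l j)) := by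
        rw [setLIntegral_const]
        gcongr
        exact volume_shell_le j
    _ = C * (4 * S) * ENNReal.ofReal (s.R j ^ 2 * s.R k * (s.l j * s.l k)) := by
        rw [mul_mul_mul_comm, ← ENNReal.ofReal_mul (by nlinarith [s.l_le k])]
        ring_nf
    _ ≤ C * (4 * S) * ENNReal.ofReal
          (s.R j ^ (3 / 2 : ℝ) * s.R k ^ (3 / 2 : ℝ) * (s.l j * s.l k)) := by
        gcongr _ * ENNReal.ofReal (?_ * _)
        exact sq_mul_le_rpow_mul_rpow hRj hjk
    _ = _ := by
        rw [← ENNReal.ofReal_mul (by positivity)]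
        ring_nf

lemma lintegral_sq_sum_mul_le (s : Shells) {F : R3 → ℝ≥0∞} (hF : Measurable F) :
    ∫⁻ x, ENNReal.ofReal (s.sum x ^ 2) * F x ≤
      ∑' k, ENNReal.ofReal (s.h k ^ 2) * ∫⁻ x in s.shell k, F x := by
  refine lintegral_comp_tsum_mul_le term_eq_zero (G := fun t => ENNReal.ofReal (t ^ 2)) (by simp)
    (fun k x => ?_) hF
  rw [← sq_abs]
  gcongr
  exact norm_term_le k x

lemma energy_sum_le (s : Shells) : energy s.sum ≤ ∑' j, ENNReal.ofReal (s.h j ^ 2) *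
    ∑' k, ENNReal.ofReal (s.h k ^ 2) * s.mutualEnergy j k := by
  have hK : Measurable fun z : R3 × R3 => ENNReal.ofReal (1 / ‖z.1 - z.2‖) := by fun_prop
  have hKx (x : R3) : Measurable fun y : R3 => ENNReal.ofReal (1 / ‖x - y‖) := by fun_prop
  have hV (k : ℕ) : Measurable fun x => ENNReal.ofReal (s.h k ^ 2) *
      ∫⁻ y in s.shell k, ENNReal.ofReal (1 / ‖x - y‖) := hK.lintegral_prod_right'.const_mul _
  calc energy s.sum
      ≤ ∫⁻ x, ENNReal.ofReal (s.sum x ^ 2) * ∑' k, ENNReal.ofReal (s.h k ^ 2) *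
          ∫⁻ y in s.shell k, ENNReal.ofReal (1 / ‖x - y‖) := by
        rw [energy_eq]
        gcongr with x
        exact s.lintegral_sq_sum_mul_le (hKx x)
    _ ≤ ∑' j, ENNReal.ofReal (s.h j ^ 2) * ∫⁻ x in s.shell j, ∑' k, ENNReal.ofReal (s.h k ^ 2) *
          ∫⁻ y in s.shell k, ENNReal.ofReal (1 / ‖x - y‖) :=
        s.lintegral_sq_sum_mul_le (.tsum hV)
    _ = ∑' j, ENNReal.ofReal (s.h j ^ 2) *
          ∑' k, ENNReal.ofReal (s.h k ^ 2) * s.mutualEnergy j k := by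
        refine tsum_congr fun j => ?_
        rw [lintegral_tsum fun k => (hV k).aemeasurable]
        simp_rw [lintegral_const_mul' _ _ ENNReal.ofReal_ne_top, mutualEnergy]

lemma energy_sum_lt_top (hsum : Summable fun k => s.h k ^ 2 * (s.R k ^ (3 / 2 : ℝ) * s.l k)) :
    energy s.sum < ⊤ := by
  obtain ⟨C, hC⟩ := exists_mutualEnergy_le
  have hw (k : ℕ) : ENNReal.ofReal (s.h k ^ 2 * (s.R k ^ (3 / 2 : ℝ) * s.l k)) =
      ENNReal.ofReal (s.h k ^ 2) * ENNReal.ofReal (s.R k ^ (3 / 2 : ℝ) * s.l k) :=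
    ENNReal.ofReal_mul (sq_nonneg _)
  calc energy s.sum
      ≤ ∑' j, ENNReal.ofReal (s.h j ^ 2) *
          ∑' k, ENNReal.ofReal (s.h k ^ 2) * s.mutualEnergy j k := energy_sum_le s
    _ ≤ ∑' j, ENNReal.ofReal (s.h j ^ 2) * ∑' k, ENNReal.ofReal (s.h k ^ 2) *
          (C * (ENNReal.ofReal (s.R j ^ (3 / 2 : ℝ) * s.l j) *
            ENNReal.ofReal (s.R k ^ (3 / 2 : ℝ) * s.l k))) := by
        gcongr
        exact hC s _ _
    _ = C * (∑' j, ENNReal.ofReal (s.h j ^ 2 * (s.R j ^ (3 / 2 : ℝ) * s.l j)) *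
          ∑' k, ENNReal.ofReal (s.h k ^ 2 * (s.R k ^ (3 / 2 : ℝ) * s.l k))) := by
        simp_rw [hw, ← ENNReal.tsum_mul_left]
        congr! 4
        ring
    _ < ⊤ := by
        rw [ENNReal.tsum_mul_right]
        have := hsum.tsum_ofReal_ne_top
        finiteness

lemma memEr_sum (h6 : Summable fun k => s.h k ^ 6 * (s.R k ^ 2 * s.l k))
    (hgrad : Summable fun k => s.h k ^ 2 * s.R k ^ 2 / s.l k)
    (henergy : Summable fun k => s.h k ^ 2 * (s.R k ^ (3 / 2 : ℝ) * s.l k)) : MemEr s.sum where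
  memD12 := by
    have hu := memLp_six_sum h6
    have hg := memLp_two_sumGrad hgrad
    exact ⟨hu, _, isWeakGradient_sum (hu.locallyIntegrable (by norm_num))
      (hg.locallyIntegrable (by norm_num)), hg⟩
  energy_lt_top := energy_sum_lt_top henergy
  radial := isRadial_sum s

end Energy

section NotMemLp

/-- The middle half of a shell, on which the bump is equal to its height. -/
def core (s : Shells) (k : ℕ) : Set R3 :=
  norm ⁻¹' Ioc (s.R k + s.l k / 4) (s.R k + 3 * s.l k / 4)

lemma le_volume_core (k : ℕ) :
    (volume : Measure R3).toSphere univ * ENNReal.ofReal (s.R k ^ 2 * s.l k / 2) ≤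
      volume (s.core k) := by
  have hl := s.l_pos k
  have hR : 0 < s.R k := R_pos k
  refine le_trans ?_ (le_volume_preimage_norm_Ioc (by positivity) _)
  gcongr
  nlinarith [mul_pos hR hl, sq_nonneg (s.l k)]

lemma term_eq_of_mem_core {k : ℕ} {x : R3} (hx : x ∈ s.core k) : s.term k x = s.h k := by
  have hl := s.l_pos k
  rw [term, profile, bump_eq_one, mul_one]
  constructor
  · rw [le_div_iff₀ hl]
    linarith [hx.1]
  · rw [div_le_iff₀ hl]
    linarith [hx.2]

lemma le_lintegral_term_rpow {q : ℝ} (hq : 0 ≤ q) (k : ℕ) :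
    (volume : Measure R3).toSphere univ * ENNReal.ofReal (s.h k ^ q * (s.R k ^ 2 * s.l k) / 2) ≤
      ∫⁻ x, ‖s.term k x‖ₑ ^ q := by
  have hh : 0 ≤ s.h k := (s.h_pos k).le
  calc (volume : Measure R3).toSphere univ * ENNReal.ofReal (s.h k ^ q * (s.R k ^ 2 * s.l k) / 2)
      = ENNReal.ofReal (s.h k ^ q) *
          ((volume : Measure R3).toSphere univ * ENNReal.ofReal (s.R k ^ 2 * s.l k / 2)) := by
        rw [mul_div_assoc, ENNReal.ofReal_mul (by positivity), mul_left_comm]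
    _ ≤ ENNReal.ofReal (s.h k ^ q) * volume (s.core k) := by
        gcongr
        exact le_volume_core k
    _ = ∫⁻ x in s.core k, ‖s.term k x‖ₑ ^ q := by
        rw [← setLIntegral_const, ← ENNReal.ofReal_rpow_of_nonneg hh hq]
        refine setLIntegral_congr_fun (measurable_norm measurableSet_Ioc) fun x hx => ?_
        rw [term_eq_of_mem_core hx, Real.enorm_of_nonneg hh]
    _ ≤ ∫⁻ x, ‖s.term k x‖ₑ ^ q := setLIntegral_le_lintegral _ _

lemma not_memLp_sum {p : ℝ≥0∞} (hp0 : p ≠ 0) (hpt : p ≠ ⊤)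
    (hp : ∀ k, 1 ≤ s.h k ^ p.toReal * (s.R k ^ 2 * s.l k)) : ¬MemLp s.sum p := by
  have hq := ENNReal.toReal_pos hp0 hpt
  set c := (volume : Measure R3).toSphere univ * ENNReal.ofReal (1 / 2)
  have hc : c ≠ 0 := by simp [c, Real.pi_pos]
  have htop : ∫⁻ x, ‖s.sum x‖ₑ ^ p.toReal = ⊤ := by
    refine top_le_iff.1 ?_
    calc ⊤ = ∑' _ : ℕ, c := (ENNReal.tsum_const_eq_top_of_ne_zero hc).symm
      _ ≤ ∑' k, ∫⁻ x, ‖s.term k x‖ₑ ^ p.toReal := by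
          refine ENNReal.tsum_le_tsum fun k => le_trans ?_ (le_lintegral_term_rpow hq.le k)
          dsimp only [c]
          gcongr
          exact hp k
      _ = ∫⁻ x, ‖s.sum x‖ₑ ^ p.toReal := by
          rw [← lintegral_tsum fun k => (contDiff_term.continuous.enorm.measurable.pow_const
            p.toReal).aemeasurable]
          exact lintegral_congr fun x =>
            (comp_tsum term_eq_zero (G := fun t => ‖t‖ₑ ^ p.toReal) (by simp [hq]) x).symm
  exact fun h => ((eLpNorm_lt_top_iff_lintegral_rpow_enorm_lt_top hp0 hpt).1 h.2).ne htop

end NotMemLp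

end Shells

section Geometric

lemma geometric_disjoint {a b : ℝ} (hb : 0 < b) (hba : b ≤ a) (ha : a ≤ 1 / 2 ∨ 2 ≤ a) :
    Pairwise fun j k => Disjoint (Ioc (a ^ j) (a ^ j + b ^ j)) (Ioc (a ^ k) (a ^ k + b ^ k)) := by
  have ha0 := hb.trans_le hba
  have htwice (k : ℕ) : a ^ k + b ^ k ≤ 2 * a ^ k := by
    linarith [pow_le_pow_left₀ hb.le hba k]
  refine (pairwise_disjoint_on fun k => Ioc (a ^ k) (a ^ k + b ^ k)).2 fun j k hjk => ?_
  rcases ha with ha | ha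
  · refine (Ioc_disjoint_Ioc_of_le ?_).symm
    calc a ^ k + b ^ k ≤ 2 * a ^ k := htwice k
      _ ≤ 2 * a ^ (j + 1) := by
          gcongr 2 * ?_
          exact pow_le_pow_of_le_one ha0.le (by linarith) hjk
      _ ≤ a ^ j := by
          rw [pow_succ]
          nlinarith [pow_pos ha0 j]
  · refine Ioc_disjoint_Ioc_of_le ?_
    calc a ^ j + b ^ j ≤ 2 * a ^ j := htwice j
      _ ≤ a ^ (j + 1) := by
          rw [pow_succ]
          nlinarith [pow_pos ha0 j]
      _ ≤ a ^ k := pow_le_pow_right₀ (by linarith) hjk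

/-- Shells whose radii, thicknesses and heights are powers of `a`, `b` and `c`. -/
noncomputable def geometricShells {a b c : ℝ} (hb : 0 < b) (hba : b ≤ a) (hc : 0 < c)
    (ha : a ≤ 1 / 2 ∨ 2 ≤ a) : Shells where
  R k := a ^ k
  l k := b ^ k
  h k := c ^ k
  l_pos k := pow_pos hb k
  l_le k := pow_le_pow_left₀ hb.le hba k
  h_pos k := pow_pos hc k
  disjoint := geometric_disjoint hb hba ha

lemma exists_memEr_not_memLp_of_geometric {p : ℝ≥0∞} (hp0 : p ≠ 0) (hpt : p ≠ ⊤) {a b c : ℝ}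
    (hb : 0 < b) (hba : b ≤ a) (hc : 0 < c) (ha : a ≤ 1 / 2 ∨ 2 ≤ a)
    (h6 : c ^ 6 * (a ^ 2 * b) < 1) (hgrad : c ^ 2 * a ^ 2 / b < 1)
    (henergy : c ^ 2 * (a ^ (3 / 2 : ℝ) * b) < 1) (hp : 1 ≤ c ^ p.toReal * (a ^ 2 * b)) :
    ∃ u, MemEr u ∧ ¬MemLp u p volume := by
  have ha0 := hb.trans_le hba
  set s := geometricShells hb hba hc ha
  refine ⟨s.sum, Shells.memEr_sum ?_ ?_ ?_, Shells.not_memLp_sum hp0 hpt fun k => ?_⟩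
  · refine (summable_geometric_of_lt_one (by positivity) h6).congr fun k => ?_
    change _ = (c ^ k) ^ 6 * ((a ^ k) ^ 2 * b ^ k)
    ring
  · refine (summable_geometric_of_lt_one (by positivity) hgrad).congr fun k => ?_
    change _ = (c ^ k) ^ 2 * (a ^ k) ^ 2 / b ^ k
    rw [div_pow, mul_pow, pow_right_comm, pow_right_comm a]
  · refine (summable_geometric_of_lt_one (by positivity) henergy).congr fun k => ?_
    change _ = (c ^ k) ^ 2 * ((a ^ k) ^ (3 / 2 : ℝ) * b ^ k)
    rw [← Real.rpow_pow_comm ha0.le]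
    ring
  · calc 1 ≤ (c ^ p.toReal * (a ^ 2 * b)) ^ k := one_le_pow₀ hp
      _ = (c ^ k) ^ p.toReal * ((a ^ k) ^ 2 * b ^ k) := by
          rw [← Real.rpow_pow_comm hc.le]
          ring

lemma exists_memEr_not_memLp_of_lt {p : ℝ≥0∞} (hp0 : 0 < p) (hp : p < 18 / 7) :
    ∃ u, MemEr u ∧ ¬MemLp u p volume := by
  have hpt : p ≠ ⊤ := hp.ne_top
  have hq : 0 < p.toReal := ENNReal.toReal_pos hp0.ne' hpt
  have hq' : p.toReal < 18 / 7 := by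
    simpa using (ENNReal.toReal_lt_toReal hpt (by finiteness)).2 hp
  set c : ℝ := (1 / 512) ^ (p.toReal)⁻¹
  have hc : 0 < c := by positivity
  have hc2 : c ^ 2 < 1 / 128 := by
    calc c ^ 2 = (1 / 512 : ℝ) ^ (2 / p.toReal) := by
          rw [← Real.rpow_mul_natCast (by norm_num)]
          ring_nf
      _ < (1 / 512 : ℝ) ^ (7 / 9 : ℝ) := by
          refine Real.rpow_lt_rpow_of_exponent_gt (by norm_num) (by norm_num) ?_
          rw [lt_div_iff₀ hq]
          linarith
      _ = 1 / 128 := by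
          rw [show (1 / 512 : ℝ) = (1 / 2) ^ (9 : ℝ) by norm_num, ← Real.rpow_mul (by norm_num)]
          norm_num
  have hpow : (16 : ℝ) ^ (3 / 2 : ℝ) = 64 := by
    rw [show (16 : ℝ) = 4 ^ (2 : ℝ) by norm_num, ← Real.rpow_mul (by norm_num)]
    norm_num
  refine exists_memEr_not_memLp_of_geometric hp0.ne' hpt (a := 16) (b := 2) two_pos (by norm_num)
    hc (by norm_num) ?_ (by linarith) (by rw [hpow]; linarith) ?_
  · calc c ^ 6 * (16 ^ 2 * 2) = (c ^ 2) ^ 3 * 512 := by ring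
      _ < (1 / 128) ^ 3 * 512 := by gcongr
      _ < 1 := by norm_num
  · rw [Real.rpow_inv_rpow (by norm_num) hq.ne']
    norm_num

lemma exists_memEr_not_memLp_of_gt {p : ℝ≥0∞} (hpt : p ≠ ⊤) (hp : 6 < p) :
    ∃ u, MemEr u ∧ ¬MemLp u p volume := by
  have hq : 6 < p.toReal := by
    simpa using (ENNReal.toReal_lt_toReal (by finiteness) hpt).2 hp
  set c : ℝ := 8 ^ (p.toReal)⁻¹
  have hc : 0 < c := by positivity
  have hc2 : c ^ 2 < 2 := by
    calc c ^ 2 = (8 : ℝ) ^ (2 / p.toReal) := by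
          rw [← Real.rpow_mul_natCast (by norm_num)]
          ring_nf
      _ < (8 : ℝ) ^ (1 / 3 : ℝ) := by
          refine Real.rpow_lt_rpow_of_exponent_lt (by norm_num) ?_
          rw [div_lt_iff₀ (by linarith)]
          linarith
      _ = 2 := by
          rw [show (8 : ℝ) = 2 ^ (3 : ℝ) by norm_num, ← Real.rpow_mul (by norm_num)]
          norm_num
  have hpow : (1 / 2 : ℝ) ^ (3 / 2 : ℝ) ≤ 1 :=
    Real.rpow_le_one (by norm_num) (by norm_num) (by norm_num)
  refine exists_memEr_not_memLp_of_geometric (bot_lt_of_lt hp).ne' hpt (a := 1 / 2) (b := 1 / 2)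
    (by norm_num) le_rfl hc (by norm_num) ?_ (by linarith) (by nlinarith) ?_
  · calc c ^ 6 * ((1 / 2) ^ 2 * (1 / 2)) = (c ^ 2) ^ 3 * (1 / 8) := by ring
      _ < 2 ^ 3 * (1 / 8) := by gcongr
      _ = 1 := by norm_num
  · rw [Real.rpow_inv_rpow (by norm_num) (by linarith)]
    norm_num

end Geometric

section Interpolation

lemma memLp_of_memLp_top {α E : Type*} {m : MeasurableSpace α} {μ : Measure α}
    [NormedAddCommGroup E] {f : α → E} {p q : ℝ≥0∞} (hp0 : p ≠ 0) (hpq : p ≤ q)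
    (hp : MemLp f p μ) (htop : MemLp f ⊤ μ) : MemLp f q μ := by
  rcases eq_or_ne q ⊤ with rfl | hqt
  · exact htop
  have hpt : p ≠ ⊤ := ne_top_of_le_ne_top hqt hpq
  have hp0' := ENNReal.toReal_pos hp0 hpt
  have hpq' : 0 ≤ q.toReal - p.toReal := sub_nonneg.2 ((ENNReal.toReal_le_toReal hpt hqt).2 hpq)
  have hM : eLpNormEssSup f μ ≠ ⊤ := by simpa using htop.2.ne
  have hint := (eLpNorm_lt_top_iff_lintegral_rpow_enorm_lt_top hp0 hpt).1 hp.2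
  refine ⟨hp.1, (eLpNorm_lt_top_iff_lintegral_rpow_enorm_lt_top
    ((pos_iff_ne_zero.2 hp0).trans_le hpq).ne' hqt).2 ?_⟩
  calc ∫⁻ x, ‖f x‖ₑ ^ q.toReal ∂μ
      ≤ ∫⁻ x, ‖f x‖ₑ ^ p.toReal * eLpNormEssSup f μ ^ (q.toReal - p.toReal) ∂μ := by
        refine lintegral_mono_ae ?_
        filter_upwards [ae_le_eLpNormEssSup (f := f) (μ := μ)] with x hx
        rw [← add_sub_cancel p.toReal q.toReal, ENNReal.rpow_add_of_nonneg _ _ hp0'.le hpq',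
          add_sub_cancel]
        gcongr
    _ = (∫⁻ x, ‖f x‖ₑ ^ p.toReal ∂μ) * eLpNormEssSup f μ ^ (q.toReal - p.toReal) :=
        lintegral_mul_const' _ _ (by finiteness)
    _ < ⊤ := by finiteness

end Interpolation

theorem not_included (p : ℝ≥0∞) (hp0 : 0 < p) (hp : p < 18 / 7 ∨ 6 < p) :
    ∃ u, MemEr u ∧ ¬MemLp u p volume := by
  rcases hp with hp | hp
  · exact exists_memEr_not_memLp_of_lt hp0 hp
  rcases eq_or_ne p ⊤ with rfl | hpt
  · obtain ⟨u, hu, hu7⟩ := exists_memEr_not_memLp_of_gt (p := 7) (by norm_num) (by norm_num)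
    exact ⟨u, hu, fun htop => hu7 (memLp_of_memLp_top (by norm_num) (by norm_num)
      hu.memD12.memLp_six htop)⟩
  · exact exists_memEr_not_memLp_of_gt hpt hp

end Coulomb

theorem theorem1p2 :
    -- continuous inclusion for `p ∈ (18/7, 6]`
    (∀ p : ℝ≥0∞, 18 / 7 < p → p ≤ 6 →
      ∃ C : ℝ≥0, ∀ u : Coulomb.R3 → ℝ, Coulomb.MemEr u →
        MemLp u p volume ∧ eLpNorm u p volume ≤ C * Coulomb.normE u) ∧
    -- compact inclusion for `p ∈ (18/7, 6)`: bounded sequences of `E_r` have subsequences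
    -- that converge in `L^p`
    (∀ p : ℝ≥0∞, 18 / 7 < p → p < 6 →
      ∀ u : ℕ → Coulomb.R3 → ℝ, (∀ n, Coulomb.MemEr (u n)) →
        (∃ M : ℝ≥0, ∀ n, Coulomb.normE (u n) ≤ M) →
        ∃ k : ℕ → ℕ, StrictMono k ∧ ∃ v : Coulomb.R3 → ℝ, MemLp v p volume ∧
          Tendsto (fun n => eLpNorm (u (k n) - v) p volume) atTop (𝓝 0)) ∧
    -- no inclusion for `p < 18/7` or `p > 6`
    (∀ p : ℝ≥0∞, 0 < p → (p < 18 / 7 ∨ 6 < p) →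
      ∃ u : Coulomb.R3 → ℝ, Coulomb.MemEr u ∧ ¬ MemLp u p volume) :=
  ⟨Coulomb.continuous_inclusion, Coulomb.compact_inclusion, Coulomb.not_included⟩
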